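/- Setting. Let $d\ge 1$ and let $T=(V,E)$ be the Cayley tree in which every vertex has exactly $d+1$ neighbours; $d(\cdot,\cdot)$ is the graph distance and $\vec E$ the set of oriented edges. Let $Q:\mathbb Z\to(0,\infty)$ be even and summable, and let $q\ge 1$. Let $l:\mathbb Z\to(0,\infty)$ be a $q$-periodic homogeneous boundary law: $l(i+q)=l(i)$ for all $i$, and for some $c>0$, $l(i)=c\big(\sum_{j\in\mathbb Z}Q(i-j)l(j)\big)^d$ for all $i\in\mathbb Z$. Put $P(i,j)=Q(i-j)l(j)/\sum_kQ(i-k)l(k)$. With $\mathbb Z_q=\{0,\dots,q-1\}$ and $T_q(i)=i \bmod q$, define $\bar P(s,m)$ for $s\in\mathbb Z_q$, $m\in\mathbb Z$ by $P(i,j)=\bar P(T_q(i),j-i)$, and let $T_qP(s,t)=\sum_{j:\,T_q(j)=t}P(s,j)$ be the fuzzy transform on $\mathbb Z_q$. The space $\Omega^\nabla$ of gradient configurations consists of all $\zeta\in\mathbb Z^{\vec E}$ with $\zeta_{\langle y,x\rangle}=-\zeta_{\langle x,y\rangle}$, with the product $\sigma$-algebra $\mathcal F^\nabla$; for $\omega\in\mathbb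 Z^V$ put $(\nabla\omega)_{\langle x,y\rangle}=\omega_y-\omega_x$. For vertices $x,y$ let $\Gamma(x,y)$ be the self-avoiding path from $x$ to $y$, and let $\vec E_w=\{\langle x,y\rangle\in\vec E: d(w,y)=d(w,x)+1\}$ be the set of edges directed away from $w$. For finite $\Lambda\subset V$ let $\partial\Lambda$ be its outer boundary, and let $\gamma_\Lambda(\cdot\mid\omega)$ be the probability measure on $\mathbb Z^V$ concentrated on height configurations $\varphi$ equal to $\omega$ off $\Lambda$ with weights proportional to $\prod_{\{x,y\}\in E,\ \{x,y\}\cap\Lambda\ne\emptyset}Q(\varphi_y-\varphi_x)$. The gradient specification $\gamma'_\Lambda(\cdot\mid\zeta)$ is the image of $\gamma_\Lambda(\cdot\mid\omega)$ under $\nabla$, for any $\omega$ with $\nabla\omega=\zeta$; it is a kernel from $(\Omega^\nabla,\mathcal T_\Lambda)$ to $(\Omega^\nabla,\mathcal F^\nabla)$, where $\mathcal T_\Lambda$ is generated by the gradient variables on the edges not meeting $\Lambda$ and by the relative heights $\sum_{b\in\Gamma(x,y)}\eta_b$, $x,y\in\partial\Lambda$. For $w\in V$, $s\in\mathbb Z_q$,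 the pinned gradient measure $\nu_{w,s}$ is the probability measure on $\Omega^\nabla$ such that for every finite connected $\Lambda\ni w$ there is a constant $c_\Lambda(w,s)>0$ with $$\nu_{w,s}(\eta_{\Lambda\cup\partial\Lambda}=\zeta_{\Lambda\cup\partial\Lambda})=c_\Lambda(w,s)\prod_{y\in\partial\Lambda}l\Big(T_q\big(s+\sum_{b\in\Gamma(w,y)}\zeta_b\big)\Big)\prod_{b\cap\Lambda\neq\emptyset}Q(\zeta_b)\quad\text{for all }\zeta\in\Omega^\nabla.$$ Theorem. The fuzzy transform $T_qP$ has a unique invariant probability distribution $\alpha$ on $\mathbb Z_q$. There is a probability measure $\nu$ on $\Omega^\nabla$ such that for every finite connected $\Lambda\subset V$, every $w\in\Lambda$ and every $\zeta\in\Omega^\nabla$ $$\nu(\eta_\Lambda=\zeta_\Lambda)=\sum_{s\in\mathbb Z_q}\alpha(s)\prod_{\langle x,y\rangle\in\vec E_w:\ x,y\in\Lambda}\bar P\Big(T_q\big(s+\sum_{b\in\Gamma(w,x)}\zeta_b\big),\ \zeta_{\langle x,y\rangle}\Big);$$ in particular the right-hand side does not depend on the pinning vertex $w\in\Lambda$.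 For each fixed $w$ the measure $\nu$ is the only probability measure with these marginals for all finite connected $\Lambda\ni w$; moreover, the pinned measures $\nu_{w,s}$ exist and are unique, and $\nu=\sum_{s\in\mathbb Z_q}\alpha(s)\,\nu_{w,s}$. The measure $\nu$ is invariant under all automorphisms of the tree, and it is a gradient Gibbs measure: for every finite $\Lambda\subset V$ (connected or not) and every bounded measurable $F:\Omega^\nabla\to\mathbb R$, $$\int F\,d\nu=\int\nu(d\zeta)\int\gamma'_\Lambda(d\tilde\zeta\mid\zeta)F(\tilde\zeta),$$ and for every $A\in\mathcal F^\nabla$, $\nu(A\mid\mathcal T_\Lambda)=\gamma'_\Lambda(A\mid\cdot)$ $\nu$-almost surely. -/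

import Mathlib

open MeasureTheory ProbabilityTheory

namespace TreeGradient

section Configurations

variable {V : Type*} {G : SimpleGraph V}

/-- The space of gradient configurations on `G`: integer-valued functions on oriented edges that
change sign when the edge is reversed, with the product (evaluation) sigma-algebra. On a tree these
are exactly the gradients of height configurations, see `grad_height`. -/
abbrev GradConfig (G : SimpleGraph V) : Type _ :=
  {η : G.Dart → ℤ // ∀ e : G.Dart, η e.symm = -η e}

/-- The gradient of a height configuration, `⟨x,y⟩ ↦ ω y - ω x`. -/
def grad (G : SimpleGraph V) (ω : V → ℤ) : GradConfig G :=
  ⟨fun e => ω e.snd - ω e.fst, fun e => by simp⟩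

/-- The unique self-avoiding path from `x` to `y` in a tree. -/
noncomputable def treePath (hG : G.IsTree) (x y : V) : G.Walk x y :=
  (hG.existsUnique_path x y).choose

/-- The sum of the gradient variables along the self-avoiding path from `x` to `y`. -/
noncomputable def pathSum (hG : G.IsTree) (ζ : GradConfig G) (x y : V) : ℤ :=
  ((treePath hG x y).darts.map ζ.1).sum

/-- The height configuration with gradient `ζ` and height `h` at `x`. -/
noncomputable def height (hG : G.IsTree) (ζ : GradConfig G) (x : V) (h : ℤ) : V → ℤ :=
  fun y => h + pathSum hG ζ x y

lemma treePath_isPath (hG : G.IsTree) (x y : V) : (treePath hG x y).IsPath :=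
  (hG.existsUnique_path x y).choose_spec.1

lemma pathSum_eq (hG : G.IsTree) (ζ : GradConfig G) {x y : V} (p : G.Walk x y) (hp : p.IsPath) :
    pathSum hG ζ x y = (p.darts.map ζ.1).sum := by
  unfold pathSum
  rw [(hG.existsUnique_path x y).unique (treePath_isPath hG x y) hp]

lemma pathSum_adj (hG : G.IsTree) (ζ : GradConfig G) (x : V) (e : G.Dart) :
    pathSum hG ζ x e.snd = pathSum hG ζ x e.fst + ζ.1 e := by
  have key : ∀ e : G.Dart, e.fst ∈ (treePath hG x e.snd).support →
      pathSum hG ζ x e.snd = pathSum hG ζ x e.fst + ζ.1 e := by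
    intro e he
    have h := hG.isAcyclic.path_concat (treePath_isPath hG x e.fst)
      (treePath_isPath hG x e.snd) e.adj he
    unfold pathSum
    rw [h]
    simp [SimpleGraph.Walk.darts_concat]
  by_cases h : e.fst ∈ (treePath hG x e.snd).support
  · exact key e h
  · have h2 : e.snd ∈ (treePath hG x e.fst).support :=
      hG.isAcyclic.mem_support_of_ne_mem_support_of_adj_of_isPath (treePath_isPath hG x e.fst)
        (treePath_isPath hG x e.snd) e.adj h
    have h3 := key e.symm h2
    rw [ζ.2 e] at h3
    simp only [SimpleGraph.Dart.symm, Prod.snd_swap, Prod.fst_swap] at h3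
    linarith

lemma grad_height (hG : G.IsTree) (ζ : GradConfig G) (x : V) (h : ℤ) :
    grad G (height hG ζ x h) = ζ := by
  ext e
  simp only [grad, height, pathSum_adj hG ζ x e]
  ring

/-- Two height configurations with the same gradient on a tree differ by a constant. -/
lemma exists_shift (hG : G.IsTree) {ω ω' : V → ℤ} (h : grad G ω = grad G ω') :
    ∃ c : ℤ, ∀ x, ω' x = ω x + c := by
  obtain ⟨r⟩ := hG.connected.nonempty
  refine ⟨ω' r - ω r, fun x => ?_⟩
  obtain ⟨p⟩ := hG.connected.preconnected r x
  have step : ∀ {u v : V} (_ : G.Walk u v), ω' v - ω v = ω' u - ω u := by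
    intro u v p
    induction p with
    | nil => rfl
    | cons hadj p ih =>
      rw [ih]
      have := congrFun (congrArg Subtype.val h) ⟨(_, _), hadj⟩
      simp only [grad] at this
      linarith
  linarith [step p]

/-- The action of a graph automorphism on gradient configurations. -/
def automAct (τ : G ≃g G) (η : GradConfig G) : GradConfig G :=
  ⟨fun e => η.1 (τ.toHom.mapDart e), fun e => η.2 (τ.toHom.mapDart e)⟩

/-- Invariance of a measure under all automorphisms of the graph. -/
def IsHomogeneous (ν : Measure (GradConfig G)) : Prop :=
  ∀ τ : G ≃g G, ν.map (automAct τ) = ν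

/-- The event that `η` agrees with `ζ` on all edges with both endpoints in `A`. -/
def cylinder (A : Finset V) (ζ : GradConfig G) : Set (GradConfig G) :=
  {η | ∀ e : G.Dart, e.fst ∈ A → e.snd ∈ A → η.1 e = ζ.1 e}

/-- The directed edges inside `A` that point away from `w`. -/
def awayDartSet (G : SimpleGraph V) (w : V) (A : Finset V) : Set G.Dart :=
  {e | e.fst ∈ A ∧ e.snd ∈ A ∧ G.dist w e.snd = G.dist w e.fst + 1}

lemma finite_awayDartSet (w : V) (A : Finset V) : (awayDartSet G w A).Finite := by
  refine Set.Finite.of_finite_image (f := fun e : G.Dart => e.toProd)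
    ((A ×ˢ A).finite_toSet.subset ?_) (SimpleGraph.Dart.toProd_injective.injOn)
  rintro _ ⟨e, ⟨h1, h2, -⟩, rfl⟩
  simp only [Finset.coe_product, Set.mem_prod, Finset.mem_coe]
  exact ⟨h1, h2⟩

noncomputable def awayDarts (G : SimpleGraph V) (w : V) (A : Finset V) : Finset G.Dart :=
  (finite_awayDartSet w A).toFinset

lemma measurable_grad : Measurable (grad G) := by
  refine Measurable.subtype_mk (measurable_pi_lambda _ fun e => ?_)
  exact (measurable_pi_apply _).sub (measurable_pi_apply _)

lemma measurable_pathSum (hG : G.IsTree) (x y : V) :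
    Measurable fun η : GradConfig G => pathSum hG η x y := by
  unfold pathSum
  induction (treePath hG x y).darts with
  | nil => simp
  | cons e t ih =>
    simp only [List.map_cons, List.sum_cons]
    exact ((measurable_pi_apply e).comp measurable_subtype_coe).add ih

lemma grad_shift (ω : V → ℤ) (c : ℤ) : grad G (fun x => ω x + c) = grad G ω := by
  ext e
  simp [grad]

end Configurations

/-- A homogeneous transfer operator: a strictly positive, even, summable function on `ℤ`
(that is `exp (-U)` for an even gradient interaction potential `U`). -/
structure TransferOperator where
  val : ℤ → ℝ
  pos : ∀ m, 0 < val m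
  even : ∀ m, val (-m) = val m
  summable : Summable val

section Specification

variable {V : Type*} [DecidableEq V] {G : SimpleGraph V} [G.LocallyFinite]

/-- The outer boundary of a finite set of vertices. -/
def outerBoundary (G : SimpleGraph V) [G.LocallyFinite] (Λ : Finset V) : Finset V :=
  (Λ.biUnion fun x => G.neighborFinset x) \ Λ

/-- The unoriented edges with at least one endpoint in `Λ`. -/
def touchingEdges (G : SimpleGraph V) [G.LocallyFinite] (Λ : Finset V) : Finset (Sym2 V) :=
  Λ.biUnion fun x => G.incidenceFinset x

/-- The value of the transfer operator at the height difference along an unoriented edge. -/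
def edgeFactor (Q : TransferOperator) (φ : V → ℤ) : Sym2 V → ℝ :=
  Sym2.lift ⟨fun x y => Q.val (φ y - φ x), fun x y => by
    simpa using Q.even (φ x - φ y)⟩

/-- The unnormalized Gibbs weight `∏_{b ∩ Λ ≠ ∅} Q (∇φ_b)`. -/
def gibbsWeight (G : SimpleGraph V) [G.LocallyFinite] (Q : TransferOperator) (Λ : Finset V)
    (φ : V → ℤ) : ℝ :=
  ∏ b ∈ touchingEdges G Λ, edgeFactor Q φ b

/-- The height configuration equal to `σ` on `Λ` and to `ω` off `Λ`. -/
def glue (Λ : Finset V) (σ : Λ → ℤ) (ω : V → ℤ) : V → ℤ :=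
  fun x => if h : x ∈ Λ then σ ⟨x, h⟩ else ω x

/-- The partition function in `Λ` with boundary condition `ω`. -/
noncomputable def partitionFunction (G : SimpleGraph V) [G.LocallyFinite] (Q : TransferOperator)
    (Λ : Finset V) (ω : V → ℤ) : ENNReal :=
  ∑' σ : Λ → ℤ, ENNReal.ofReal (gibbsWeight G Q Λ (glue Λ σ ω))

/-- The local Gibbs specification on height configurations, with the counting measure on `ℤ^Λ`
as a priori measure. -/
noncomputable def gibbsSpec (G : SimpleGraph V) [G.LocallyFinite] (Q : TransferOperator)
    (Λ : Finset V) (ω : V → ℤ) : Measure (V → ℤ) :=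
  (partitionFunction G Q Λ ω)⁻¹ • Measure.sum fun σ : Λ → ℤ =>
    ENNReal.ofReal (gibbsWeight G Q Λ (glue Λ σ ω)) • Measure.dirac (glue Λ σ ω)

/-- The gradient sigma-algebra outside `Λ`: generated by the gradient variables on edges that do
not meet `Λ`, and by the class modulo a joint height shift of the heights on the outer boundary of
`Λ`, i.e. by all height differences between vertices of the outer boundary. -/
noncomputable abbrev outerSigma (hG : G.IsTree) (Λ : Finset V) : MeasurableSpace (GradConfig G) :=
  (⨆ e : {e : G.Dart // e.fst ∉ Λ ∧ e.snd ∉ Λ},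
      MeasurableSpace.comap (fun η : GradConfig G => η.1 e.1) ⊤) ⊔
    (⨆ p : outerBoundary G Λ × outerBoundary G Λ,
      MeasurableSpace.comap (fun η : GradConfig G => pathSum hG η p.1 p.2) ⊤)

lemma outerSigma_le (hG : G.IsTree) (Λ : Finset V) :
    outerSigma hG Λ ≤ (inferInstance : MeasurableSpace (GradConfig G)) := by
  refine sup_le (iSup_le fun e => ?_) (iSup_le fun p => ?_)
  · exact ((measurable_pi_apply e.1).comp measurable_subtype_coe).comap_le
  · exact (measurable_pathSum hG _ _).comap_le

lemma map_gibbsSpec_apply (Q : TransferOperator) (Λ : Finset V) (ω : V → ℤ)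
    {A : Set (GradConfig G)} (hA : MeasurableSet A) :
    ((gibbsSpec G Q Λ ω).map (grad G)) A = (partitionFunction G Q Λ ω)⁻¹ *
      ∑' σ : Λ → ℤ, ENNReal.ofReal (gibbsWeight G Q Λ (glue Λ σ ω)) *
        A.indicator 1 (grad G (glue Λ σ ω)) := by
  rw [Measure.map_apply measurable_grad hA, gibbsSpec, Measure.smul_apply,
    Measure.sum_apply _ (measurable_grad hA), smul_eq_mul]
  congr 1
  refine tsum_congr fun σ => ?_
  rw [Measure.smul_apply, Measure.dirac_apply' _ (measurable_grad hA), smul_eq_mul]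
  rfl

lemma glue_shift (Λ : Finset V) (σ : Λ → ℤ) (ω : V → ℤ) (c : ℤ) :
    glue Λ (fun x => σ x + c) (fun x => ω x + c) = fun x => glue Λ σ ω x + c := by
  funext x
  by_cases h : x ∈ Λ <;> simp [glue, h]

lemma gibbsWeight_shift (Q : TransferOperator) (Λ : Finset V) (φ : V → ℤ) (c : ℤ) :
    gibbsWeight G Q Λ (fun x => φ x + c) = gibbsWeight G Q Λ φ := by
  refine Finset.prod_congr rfl fun b _ => ?_
  induction b with
  | _ x y => simp [edgeFactor]

lemma map_gibbsSpec_shift (Q : TransferOperator) (Λ : Finset V) (ω : V → ℤ) (c : ℤ) :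
    (gibbsSpec G Q Λ (fun x => ω x + c)).map (grad G) = (gibbsSpec G Q Λ ω).map (grad G) := by
  ext A hA
  rw [map_gibbsSpec_apply Q Λ _ hA, map_gibbsSpec_apply Q Λ _ hA]
  congr 1
  · unfold partitionFunction
    rw [← (Equiv.addRight (fun _ : Λ => c)).tsum_eq]
    congr 1
    refine tsum_congr fun σ => ?_
    have := glue_shift Λ σ ω c
    simp only [Equiv.coe_addRight]
    change ENNReal.ofReal (gibbsWeight G Q Λ (glue Λ (fun x => σ x + c) _)) = _
    rw [this, gibbsWeight_shift]
  · rw [← (Equiv.addRight (fun _ : Λ => c)).tsum_eq]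
    refine tsum_congr fun σ => ?_
    have := glue_shift Λ σ ω c
    simp only [Equiv.coe_addRight]
    change ENNReal.ofReal (gibbsWeight G Q Λ (glue Λ (fun x => σ x + c) _)) *
      A.indicator 1 (grad G (glue Λ (fun x => σ x + c) _)) = _
    rw [this, gibbsWeight_shift, grad_shift]

lemma map_gibbsSpec_congr (hG : G.IsTree) (Q : TransferOperator) (Λ : Finset V) {ω ω' : V → ℤ}
    (h : grad G ω = grad G ω') :
    (gibbsSpec G Q Λ ω).map (grad G) = (gibbsSpec G Q Λ ω').map (grad G) := by
  obtain ⟨c, hc⟩ := exists_shift hG h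
  rw [show ω' = fun x => ω x + c from funext hc, map_gibbsSpec_shift]

lemma mem_outerBoundary_of_adj {Λ : Finset V} {x y : V} (hx : x ∈ Λ) (h : G.Adj x y)
    (hy : y ∉ Λ) : y ∈ outerBoundary G Λ := by
  simp only [outerBoundary, Finset.mem_sdiff, Finset.mem_biUnion, SimpleGraph.mem_neighborFinset]
  exact ⟨⟨x, hx, h⟩, hy⟩

lemma measurable_glue_height {α : Type*} [MeasurableSpace α] (hG : G.IsTree) (Λ : Finset V)
    (f : α → GradConfig G) (x₀ : V)
    (hp : ∀ y ∈ outerBoundary G Λ, Measurable fun a => pathSum hG (f a) x₀ y)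
    (σ : Λ → ℤ) {y : V} (hy : y ∈ Λ ∨ y ∈ outerBoundary G Λ) :
    Measurable fun a => glue Λ σ (height hG (f a) x₀ 0) y := by
  by_cases h : y ∈ Λ
  · simp [glue, h]
  · simpa [glue, h, height] using hp y (hy.resolve_left h)

lemma measurable_kernel_aux {α : Type*} [MeasurableSpace α] (hG : G.IsTree) (Q : TransferOperator)
    (Λ : Finset V) (f : α → GradConfig G) (x₀ : V)
    (he : ∀ e : G.Dart, e.fst ∉ Λ → e.snd ∉ Λ → Measurable fun a => (f a).1 e)
    (hp : ∀ y ∈ outerBoundary G Λ, Measurable fun a => pathSum hG (f a) x₀ y) :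
    Measurable fun a => (gibbsSpec G Q Λ (height hG (f a) x₀ 0)).map (grad G) := by
  have hw : ∀ σ : Λ → ℤ, Measurable fun a =>
      ENNReal.ofReal (gibbsWeight G Q Λ (glue Λ σ (height hG (f a) x₀ 0))) := by
    intro σ
    refine ENNReal.measurable_ofReal.comp ?_
    unfold gibbsWeight
    refine Finset.measurable_prod _ fun b hb => ?_
    simp only [touchingEdges, Finset.mem_biUnion, SimpleGraph.mem_incidenceFinset] at hb
    obtain ⟨x, hx, hbx⟩ := hb
    obtain ⟨y, rfl⟩ := Sym2.mem_iff_exists.1 hbx.2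
    have hadj : G.Adj x y := hbx.1
    have hy : y ∈ Λ ∨ y ∈ outerBoundary G Λ := by
      by_cases h : y ∈ Λ
      · exact Or.inl h
      · exact Or.inr (mem_outerBoundary_of_adj hx hadj h)
    have h1 := measurable_glue_height hG Λ f x₀ hp σ (Or.inl hx)
    have h2 := measurable_glue_height hG Λ f x₀ hp σ hy
    exact (measurable_from_top (f := Q.val)).comp (h2.sub h1)
  have hg : ∀ σ : Λ → ℤ, Measurable fun a => grad G (glue Λ σ (height hG (f a) x₀ 0)) := by
    intro σ
    refine Measurable.subtype_mk (measurable_pi_lambda _ fun e => ?_)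
    by_cases h1 : e.fst ∈ Λ
    · have h2 : e.snd ∈ Λ ∨ e.snd ∈ outerBoundary G Λ := by
        by_cases h : e.snd ∈ Λ
        · exact Or.inl h
        · exact Or.inr (mem_outerBoundary_of_adj h1 e.adj h)
      exact (measurable_glue_height hG Λ f x₀ hp σ h2).sub
        (measurable_glue_height hG Λ f x₀ hp σ (Or.inl h1))
    · by_cases h2 : e.snd ∈ Λ
      · exact (measurable_glue_height hG Λ f x₀ hp σ (Or.inl h2)).sub
          (measurable_glue_height hG Λ f x₀ hp σ
            (Or.inr (mem_outerBoundary_of_adj h2 e.adj.symm h1)))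
      · have := he e h1 h2
        simpa [glue, h1, h2, height, pathSum_adj hG _ x₀ e] using this
  refine Measure.measurable_of_measurable_coe _ fun A hA => ?_
  simp only [map_gibbsSpec_apply Q Λ _ hA]
  refine Measurable.mul (Measurable.inv ?_) (Measurable.tsum fun σ => (hw σ).mul ?_)
  · exact Measurable.tsum hw
  · exact (measurable_one.indicator hA).comp (hg σ)

lemma measurable_kernel (hG : G.IsTree) (Q : TransferOperator) (Λ : Finset V) (r : V) :
    Measurable[outerSigma hG Λ] fun ζ : GradConfig G =>
      (gibbsSpec G Q Λ (height hG ζ r 0)).map (grad G) := by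
  obtain ⟨x₀, hx₀⟩ : ∃ x₀, ∀ y ∈ outerBoundary G Λ, x₀ ∈ outerBoundary G Λ := by
    rcases (outerBoundary G Λ).eq_empty_or_nonempty with h | ⟨x, hx⟩
    · exact ⟨r, by simp [h]⟩
    · exact ⟨x, fun _ _ => hx⟩
  have h : (fun ζ : GradConfig G => (gibbsSpec G Q Λ (height hG ζ r 0)).map (grad G)) =
      fun ζ => (gibbsSpec G Q Λ (height hG ζ x₀ 0)).map (grad G) := by
    funext ζ
    exact map_gibbsSpec_congr hG Q Λ (by rw [grad_height, grad_height])
  rw [h]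
  refine @measurable_kernel_aux V _ G _ (GradConfig G) (outerSigma hG Λ) hG Q Λ (fun ζ => ζ) x₀
    (fun e h1 h2 => ?_) (fun y hy => ?_)
  · refine Measurable.of_comap_le (le_trans ?_ le_sup_left)
    exact le_iSup (fun e : {e : G.Dart // e.fst ∉ Λ ∧ e.snd ∉ Λ} =>
      MeasurableSpace.comap (fun η : GradConfig G => η.1 e.1) ⊤) ⟨e, h1, h2⟩
  · refine Measurable.of_comap_le (le_trans ?_ le_sup_right)
    exact le_iSup (fun p : outerBoundary G Λ × outerBoundary G Λ =>
      MeasurableSpace.comap (fun η : GradConfig G => pathSum hG η p.1 p.2) ⊤)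
      (⟨x₀, hx₀ y hy⟩, ⟨y, hy⟩)

/-- The gradient Gibbs specification: the kernel from `(Ω^∇, 𝒯_Λ)` to `(Ω^∇, ℱ^∇)` sending `ζ` to
the image under the gradient map of the Gibbs kernel at any height configuration with gradient `ζ`
(see `gradSpec_grad` for the independence of the choice of the height configuration). -/
noncomputable def gradSpec (hG : G.IsTree) (Q : TransferOperator) (Λ : Finset V) :
    @Kernel (GradConfig G) (GradConfig G) (outerSigma hG Λ) inferInstance :=
  @Kernel.mk (GradConfig G) (GradConfig G) (outerSigma hG Λ) inferInstance
    (fun ζ => (gibbsSpec G Q Λ (height hG ζ hG.connected.nonempty.some 0)).map (grad G))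
    (measurable_kernel hG Q Λ _)

lemma gradSpec_grad (hG : G.IsTree) (Q : TransferOperator) (Λ : Finset V) (ω : V → ℤ) :
    gradSpec hG Q Λ (grad G ω) = (gibbsSpec G Q Λ ω).map (grad G) :=
  map_gibbsSpec_congr hG Q Λ (grad_height hG _ _ _)

/-- A probability measure on gradient configurations is a gradient Gibbs measure if it satisfies
the DLR equation for the gradient specification, in every finite volume and for all bounded
measurable functions. -/
def IsGradientGibbs (hG : G.IsTree) (Q : TransferOperator) (ν : Measure (GradConfig G)) : Prop :=
  IsProbabilityMeasure ν ∧
    ∀ (Λ : Finset V) (F : GradConfig G → ℝ), Measurable F → (∃ C, ∀ ζ, |F ζ| ≤ C) →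
      ∫ ζ, F ζ ∂ν = ∫ ζ, (∫ ξ, F ξ ∂(gradSpec hG Q Λ ζ)) ∂ν

/-- The conditional probabilities of `ν` given the gradient sigma-algebra outside each finite
volume are given by the gradient specification. -/
def HasGradientConditionals (hG : G.IsTree) (Q : TransferOperator) (ν : Measure (GradConfig G)) :
    Prop :=
  ∀ (Λ : Finset V) (A : Set (GradConfig G)), MeasurableSet A →
    ν⟦A | outerSigma hG Λ⟧ =ᵐ[ν] fun ζ => (gradSpec hG Q Λ ζ).real A

end Specification

section BoundaryLaw

/-- A spatially homogeneous boundary law for `Q` on the Cayley tree in which every vertex has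
`d + 1` neighbours. -/
def IsBoundaryLaw (Q : TransferOperator) (d : ℕ) (l : ℤ → ℝ) : Prop :=
  (∀ i, 0 < l i) ∧ ∃ c : ℝ, 0 < c ∧ ∀ i : ℤ, l i = c * (∑' j : ℤ, Q.val (i - j) * l j) ^ d

/-- The transition matrix on `ℤ` associated with a boundary law. -/
noncomputable def transition (Q : TransferOperator) (l : ℤ → ℝ) (i j : ℤ) : ℝ :=
  Q.val (i - j) * l j / ∑' k : ℤ, Q.val (i - k) * l k

/-- The probability of the height increase `m` at a vertex in the layer `s`; here `s` is
represented by its element in `{0, …, q - 1}`. -/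
noncomputable def layerTransition (Q : TransferOperator) (l : ℤ → ℝ) {q : ℕ} (s : ZMod q) (m : ℤ) :
    ℝ :=
  transition Q l (s.val : ℤ) ((s.val : ℤ) + m)

/-- The mod-`q` fuzzy transform of the transition matrix. -/
noncomputable def fuzzyTransition (Q : TransferOperator) (l : ℤ → ℝ) {q : ℕ} (s t : ZMod q) : ℝ :=
  ∑' j : {j : ℤ // (j : ZMod q) = t}, transition Q l (s.val : ℤ) j

/-- `α` is an invariant probability distribution of the fuzzy transform. -/
def IsInvariantDistribution (Q : TransferOperator) (l : ℤ → ℝ) {q : ℕ} [NeZero q]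
    (α : ZMod q → ℝ) : Prop :=
  (∀ s, 0 ≤ α s) ∧ ∑ s, α s = 1 ∧ ∀ t, ∑ s, α s * fuzzyTransition Q l s t = α t

variable {V : Type*} {G : SimpleGraph V}

/-- The layer at `y` obtained by starting in the layer `s` at `w` and walking to `y` according to
the gradient configuration `ζ`. -/
noncomputable def layer (hG : G.IsTree) {q : ℕ} (w : V) (s : ZMod q) (ζ : GradConfig G) (y : V) :
    ZMod q :=
  s + (pathSum hG ζ w y : ZMod q)

/-- The weight of `ζ` in the volume `Λ` for the chain started in the layer `s` at `w`: the product
of the layer transition probabilities over the edges of `Λ` directed away from `w`. -/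
noncomputable def chainWeight (hG : G.IsTree) (Q : TransferOperator) (l : ℤ → ℝ) {q : ℕ}
    (w : V) (s : ZMod q) (Λ : Finset V) (ζ : GradConfig G) : ℝ :=
  ∏ e ∈ awayDarts G w Λ, layerTransition Q l (layer hG w s ζ e.fst) (ζ.1 e)

/-- `ν` has the marginals of the mixture over `s`, distributed according to `α`, of the chains
started in the layer `s` at `w`, in all finite connected volumes containing `w`. -/
def HasMixtureMarginals (hG : G.IsTree) (Q : TransferOperator) (l : ℤ → ℝ) {q : ℕ} [NeZero q]
    (α : ZMod q → ℝ) (w : V) (ν : Measure (GradConfig G)) : Prop :=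
  ∀ Λ : Finset V, w ∈ Λ → (G.induce (Λ : Set V)).Connected → ∀ ζ : GradConfig G,
    ν.real (cylinder Λ ζ) = ∑ s : ZMod q, α s * chainWeight hG Q l w s Λ ζ

/-- `μ` is the gradient measure pinned to the layer `s` at the vertex `w`: a probability measure
whose marginals on `Λ ∪ ∂Λ` are given by boundary law terms on `∂Λ` and transfer operators on the
edges meeting `Λ`, up to a normalization factor. -/
def IsPinnedGradientMeasure [DecidableEq V] [G.LocallyFinite] (hG : G.IsTree)
    (Q : TransferOperator) (l : ℤ → ℝ) {q : ℕ} (w : V) (s : ZMod q)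
    (μ : Measure (GradConfig G)) : Prop :=
  IsProbabilityMeasure μ ∧
    ∀ Λ : Finset V, w ∈ Λ → (G.induce (Λ : Set V)).Connected →
      ∃ c : ℝ, 0 < c ∧ ∀ ζ : GradConfig G,
        μ.real (cylinder (Λ ∪ outerBoundary G Λ) ζ) =
          c * (∏ y ∈ outerBoundary G Λ, l ((layer hG w s ζ y).val : ℤ)) *
            gibbsWeight G Q Λ (height hG ζ w 0)

end BoundaryLaw

end TreeGradient

open TreeGradient

/-! Write `R i` for `rowSum Q l i`, so that `P(i,j) = Q(i-j) l(j) / R i`. Multiply the chain's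
transition probabilities over all edges of `Δ ∪ ∂Δ` pointing away from `w`. Each vertex other than
`w` is the head of one such edge and contributes `l`; a vertex of `Δ` contributes `R⁻¹` once per
child, that is `d` times, and `d + 1` times at the root. The boundary law equation `l = c R^d`
cancels these factors at interior vertices. What remains is the Boltzmann weight `∏_{∂Δ} l · ∏
Q(∇φ)` times `c^|Δ| / (l R)` evaluated at the height of `w` (`chainWeight_eq_boltzmannWeight`). This
already has the pinned form.

Since `Q` is even, the fuzzy chain is reversible with respect to `α(s) = l(s) R(s) / Z`, and
positivity of its matrix makes `α` the only invariant distribution. Mixing with `α` removes exactly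
the factor `1 / (l R)`: the marginal becomes `c^|Δ| / Z` times the sum of Boltzmann weights over one
period of joint height shifts (`sum_layerDistribution_mul_chainWeight`). This expression does not
mention `w`, so the mixtures for all pinning vertices coincide. Automorphism invariance follows
because an automorphism only moves the pinning vertex.

The chain is built from independent increments indexed by vertex and layer (`exists_chain_measure`).

For the Gibbs property, an arbitrary finite `Λ` is placed in a large ball. The period sum factors
into the Gibbs weight in `Λ`, which is shift invariant, and a term that does not depend on the
heights in `Λ` (`periodSum_glue`). Thus `ν` has the right ratios between modifications inside `Λ`.
These ratios also force the partition function to be finite, and they give `ν.bind (gradSpec hG Q Λ)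
= ν` (`bind_gradSpec_eq`). Properness of the kernel turns this identity into the statement on
conditional probabilities. -/

namespace TreeGradient

/-! ### Rooted trees, gradients as heights modulo shifts, and cylinder events -/

section Tree

variable {V : Type*} {G : SimpleGraph V}

/-- A vertex set containing `w` and, with each vertex, its neighbour in the direction of `w`. -/
structure AncestorClosed (G : SimpleGraph V) (w : V) (A : Finset V) : Prop where
  root_mem : w ∈ A
  fst_mem : ∀ ⦃x y : V⦄, G.Adj x y → G.dist w y = G.dist w x + 1 → y ∈ A → x ∈ A

/-- Geodesics to the two candidates extend to geodesics to `y`, and a tree has only one path from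
`w` to `y`. -/
lemma parent_unique (hG : G.IsTree) {w x x' y : V} (h : G.Adj x y) (h' : G.Adj x' y)
    (hd : G.dist w y = G.dist w x + 1) (hd' : G.dist w y = G.dist w x' + 1) : x = x' := by
  obtain ⟨p, -, hp⟩ := hG.connected.exists_path_of_dist w x
  obtain ⟨p', -, hp'⟩ := hG.connected.exists_path_of_dist w x'
  have h1 : (p.concat h).IsPath :=
    SimpleGraph.Walk.isPath_of_length_eq_dist _ (by simp [hp, hd])
  have h2 : (p'.concat h').IsPath :=
    SimpleGraph.Walk.isPath_of_length_eq_dist _ (by simp [hp', hd'])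
  have h3 := (hG.existsUnique_path w y).unique h1 h2
  simpa using congrArg SimpleGraph.Walk.penultimate h3

lemma exists_parent (hG : G.IsTree) {w y : V} (hy : y ≠ w) :
    ∃ x, G.Adj x y ∧ G.dist w y = G.dist w x + 1 := by
  obtain ⟨p, -, hp⟩ := hG.connected.exists_path_of_dist w y
  have hnil : ¬ p.Nil := fun h => hy h.eq.symm
  have hadj := p.adj_penultimate hnil
  refine ⟨p.penultimate, hadj, ?_⟩
  have h1 : G.dist w p.penultimate ≤ p.dropLast.length := SimpleGraph.dist_le _
  have h2 : p.dropLast.length + 1 = p.length := by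
    rw [← SimpleGraph.Walk.length_concat p.dropLast hadj, SimpleGraph.Walk.concat_dropLast]
  rcases hG.dist_eq_dist_add_one_of_adj w hadj with h | h <;> omega

lemma AncestorClosed.induction (hG : G.IsTree) {w : V} {A : Finset V}
    (hA : AncestorClosed G w A) {p : V → Prop} (h0 : p w)
    (hs : ∀ x y, G.Adj x y → G.dist w y = G.dist w x + 1 → x ∈ A → y ∈ A → p x → p y) :
    ∀ y ∈ A, p y := by
  suffices H : ∀ n, ∀ y ∈ A, G.dist w y = n → p y from fun y hy => H _ y hy rfl
  intro n
  induction n with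
  | zero =>
    intro y _ h
    rw [hG.connected.dist_eq_zero_iff] at h
    exact h ▸ h0
  | succ n ih =>
    intro y hy h
    have hne : y ≠ w := by
      rintro rfl
      simp at h
    obtain ⟨x, hx, hd⟩ := exists_parent hG hne
    have hxA := hA.fst_mem hx hd hy
    exact hs x y hx hd hxA hy (ih x hxA (by omega))

/-- A path inside `A` from `w` to `y` must be the tree path, which passes through the parent of `y`.
With `AncestorClosed.connected` this makes the notion independent of the root chosen in `A`, which
is what permits a change of pinning vertex. -/
lemma ancestorClosed_of_connected (hG : G.IsTree) {w : V} {A : Finset V} (hw : w ∈ A)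
    (hc : (G.induce (A : Set V)).Connected) : AncestorClosed G w A := by
  refine ⟨hw, fun x y hxy hd hy => ?_⟩
  obtain ⟨q, hq, -⟩ := hc.exists_path_of_dist ⟨w, hw⟩ ⟨y, hy⟩
  obtain ⟨p, -, hp⟩ := hG.connected.exists_path_of_dist w x
  have h1 : (p.concat hxy).IsPath :=
    SimpleGraph.Walk.isPath_of_length_eq_dist _ (by simp [hp, hd])
  have h2 : (q.map (SimpleGraph.Embedding.induce (A : Set V)).toHom).IsPath :=
    hq.map Subtype.val_injective
  have h3 := (hG.existsUnique_path w y).unique h1 h2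
  have h4 : ∀ z ∈ (q.map (SimpleGraph.Embedding.induce (A : Set V)).toHom).support, z ∈ A := by
    intro z hz
    rw [SimpleGraph.Walk.support_map] at hz
    obtain ⟨v, -, hv⟩ := List.mem_map.1 hz
    exact hv ▸ v.2
  exact h4 x (Eq.mp (congrArg (fun r : G.Walk w y => x ∈ r.support) h3)
    (by simp [SimpleGraph.Walk.support_concat]))

lemma AncestorClosed.connected (hG : G.IsTree) {w : V} {A : Finset V}
    (hA : AncestorClosed G w A) : (G.induce (A : Set V)).Connected := by
  have key : ∀ y ∈ A, ∀ hy : y ∈ (A : Set V),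
      (G.induce (A : Set V)).Reachable ⟨w, hA.root_mem⟩ ⟨y, hy⟩ := by
    refine hA.induction hG (fun _ => .rfl) fun x y hxy _ hx _ ih hy' => ?_
    refine (ih hx).trans (SimpleGraph.Adj.reachable ?_)
    simpa using hxy
  rw [SimpleGraph.connected_iff_exists_forall_reachable]
  exact ⟨⟨w, hA.root_mem⟩, fun y => key y.1 y.2 y.2⟩

lemma exists_grad_eq (hG : G.IsTree) (ζ : GradConfig G) : ∃ φ : V → ℤ, grad G φ = ζ :=
  ⟨_, grad_height hG ζ hG.connected.nonempty.some 0⟩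

lemma pathSum_self (hG : G.IsTree) (ζ : GradConfig G) (w : V) : pathSum hG ζ w w = 0 := by
  rw [pathSum_eq hG ζ SimpleGraph.Walk.nil (by simp)]
  simp

lemma pathSum_grad (hG : G.IsTree) (φ : V → ℤ) (x y : V) :
    pathSum hG (grad G φ) x y = φ y - φ x := by
  obtain ⟨c, hc⟩ := exists_shift hG (grad_height hG (grad G φ) x 0)
  have h1 := hc x
  have h2 := hc y
  simp only [height, pathSum_self] at h1 h2
  linarith

lemma mem_cylinder_grad (hG : G.IsTree) {w : V} {A : Finset V} (hA : AncestorClosed G w A)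
    (φ ψ : V → ℤ) :
    grad G φ ∈ cylinder A (grad G ψ) ↔ ∀ y ∈ A, φ y - φ w = ψ y - ψ w := by
  constructor
  · intro h
    refine hA.induction hG (by simp) fun x y hxy _ hx hy ih => ?_
    have := h ⟨(x, y), hxy⟩ hx hy
    simp only [grad] at this
    linarith
  · intro h e h1 h2
    simp only [grad]
    linarith [h _ h1, h _ h2]

/-- Fixing the height at one vertex removes the shift ambiguity, so agreement of gradients can be
checked height by height. -/
lemma mem_cylinder_grad_of_eq (hG : G.IsTree) {w r : V} {A : Finset V}
    (hA : AncestorClosed G w A) (hr : r ∈ A) {φ ψ : V → ℤ} (h : φ r = ψ r) :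
    grad G φ ∈ cylinder A (grad G ψ) ↔ ∀ y ∈ A, φ y = ψ y := by
  rw [mem_cylinder_grad hG hA]
  constructor
  · intro H y hy
    linarith [H y hy, H r hr]
  · intro H y hy
    rw [H y hy, H w hA.root_mem]

lemma mem_cylinder_self (A : Finset V) (ζ : GradConfig G) : ζ ∈ cylinder A ζ :=
  fun _ _ _ => rfl

lemma cylinder_eq_of_mem {A : Finset V} {ζ η : GradConfig G} (h : η ∈ cylinder A ζ) :
    cylinder A η = cylinder A ζ := by
  ext ξ
  exact ⟨fun hx e h1 h2 => (hx e h1 h2).trans (h e h1 h2),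
    fun hx e h1 h2 => (hx e h1 h2).trans (h e h1 h2).symm⟩

lemma cylinder_anti {A B : Finset V} (h : A ⊆ B) (ζ : GradConfig G) :
    cylinder B ζ ⊆ cylinder A ζ :=
  fun _ hη e h1 h2 => hη e (h h1) (h h2)

lemma finite_innerDarts (A : Finset V) : {e : G.Dart | e.fst ∈ A ∧ e.snd ∈ A}.Finite := by
  refine Set.Finite.of_finite_image (f := fun e : G.Dart => e.toProd)
    ((A ×ˢ A).finite_toSet.subset ?_) (SimpleGraph.Dart.toProd_injective.injOn)
  rintro _ ⟨e, ⟨h1, h2⟩, rfl⟩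
  simp only [Finset.coe_product, Set.mem_prod, Finset.mem_coe]
  exact ⟨h1, h2⟩

lemma measurable_eval (e : G.Dart) : Measurable fun η : GradConfig G => η.1 e :=
  (measurable_pi_apply e).comp measurable_subtype_coe

lemma measurableSet_cylinder (A : Finset V) (ζ : GradConfig G) :
    MeasurableSet (cylinder A ζ) := by
  have : cylinder A ζ =
      ⋂ e ∈ {e : G.Dart | e.fst ∈ A ∧ e.snd ∈ A}, {η : GradConfig G | η.1 e = ζ.1 e} := by
    ext η
    simp [cylinder]
  rw [this]
  exact MeasurableSet.biInter (finite_innerDarts A).countable fun e _ =>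
    measurable_eval e (measurableSet_singleton (ζ.1 e))

lemma countable_range_cylinder (A : Finset V) :
    (Set.range (cylinder A : GradConfig G → Set (GradConfig G))).Countable := by
  have := (finite_innerDarts (G := G) A).to_subtype
  let c : ({e : G.Dart // e.fst ∈ A ∧ e.snd ∈ A} → ℤ) → Set (GradConfig G) :=
    fun r => {η | ∀ e, η.1 e.1 = r e}
  have hfin : Finite {e : G.Dart // e.fst ∈ A ∧ e.snd ∈ A} := this
  refine (Set.countable_range c).mono ?_
  rintro _ ⟨ζ, rfl⟩
  refine ⟨fun e => ζ.1 e.1, ?_⟩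
  ext η
  simp [c, cylinder]

lemma pairwiseDisjoint_range_cylinder (A : Finset V) :
    (Set.range (cylinder A : GradConfig G → Set (GradConfig G))).PairwiseDisjoint id := by
  rintro _ ⟨ζ, rfl⟩ _ ⟨ζ', rfl⟩ hne
  refine Set.disjoint_left.2 fun η h1 h2 => hne ?_
  rw [← cylinder_eq_of_mem h1, cylinder_eq_of_mem h2]

lemma measure_univ_eq_tsum_cylinder (μ : Measure (GradConfig G)) (A : Finset V) :
    μ Set.univ = ∑' s : Set.range (cylinder A : GradConfig G → Set (GradConfig G)), μ s.1 := by
  rw [← measure_sUnion (countable_range_cylinder A)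
    (fun s hs t ht hne => pairwiseDisjoint_range_cylinder A hs ht hne)]
  · congr 1
    symm
    exact Set.eq_univ_of_forall fun η => ⟨_, ⟨η, rfl⟩, mem_cylinder_self A η⟩
  · rintro _ ⟨ζ, rfl⟩
    exact measurableSet_cylinder A ζ

/-- Two measures whose values on the cylinders over one finite set are proportional have
proportional total masses. -/
lemma eq_one_of_cylinder_proportional (μ μ' : Measure (GradConfig G)) [IsProbabilityMeasure μ]
    [IsProbabilityMeasure μ'] (A : Finset V) {k : ℝ} (hk : 0 < k)
    (h : ∀ ζ, μ.real (cylinder A ζ) = k * μ'.real (cylinder A ζ)) : k = 1 := by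
  have h1 := measure_univ_eq_tsum_cylinder μ A
  have h2 := measure_univ_eq_tsum_cylinder μ' A
  have h3 : ∀ s : Set.range (cylinder A : GradConfig G → Set (GradConfig G)),
      μ s.1 = ENNReal.ofReal k * μ' s.1 := by
    rintro ⟨_, ζ, rfl⟩
    rw [← ofReal_measureReal (μ := μ), h, ENNReal.ofReal_mul hk.le, ofReal_measureReal]
  rw [tsum_congr h3, ENNReal.tsum_mul_left, ← h2] at h1
  simp only [measure_univ, mul_one] at h1
  exact (ENNReal.ofReal_eq_one.1 h1.symm)

/-- A probability measure on gradient configurations is determined by its values on the cylinders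
over an exhausting sequence of finite sets. -/
lemma measure_ext_of_cylinder {μ μ' : Measure (GradConfig G)} [IsProbabilityMeasure μ]
    [IsProbabilityMeasure μ'] (A : ℕ → Finset V) (hmono : Monotone A) (hex : ∀ x, ∃ n, x ∈ A n)
    (h : ∀ n ζ, μ (cylinder (A n) ζ) = μ' (cylinder (A n) ζ)) : μ = μ' := by
  refine ext_of_generate_finite {s | ∃ n ζ, s = cylinder (A n) ζ} (le_antisymm ?_ ?_) ?_ ?_
    (by simp)
  · have he : ∀ e : G.Dart,
        Measurable[MeasurableSpace.generateFrom {s | ∃ n ζ, s = cylinder (A n) ζ}]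
          fun η : GradConfig G => η.1 e := by
      intro e
      refine @measurable_to_countable' ℤ (GradConfig G) _ _
        (MeasurableSpace.generateFrom {s | ∃ n ζ, s = cylinder (A n) ζ}) _ fun k => ?_
      obtain ⟨n1, hn1⟩ := hex e.fst
      obtain ⟨n2, hn2⟩ := hex e.snd
      set n := max n1 n2
      have hf : e.fst ∈ A n := hmono (le_max_left _ _) hn1
      have hs : e.snd ∈ A n := hmono (le_max_right _ _) hn2
      -- Once both ends of `e` lie in `A n`, the value at `e` is constant on each cylinder over `A
      -- n`, and there are only countably many of these.
      have hU : (fun η : GradConfig G => η.1 e) ⁻¹' {k} =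
          ⋃₀ (cylinder (A n) '' {ζ : GradConfig G | ζ.1 e = k}) := by
        ext η
        simp only [Set.mem_preimage, Set.mem_singleton_iff, Set.mem_sUnion, Set.mem_image,
          Set.mem_ofPred_eq, exists_exists_and_eq_and]
        exact ⟨fun h => ⟨η, h, mem_cylinder_self _ _⟩, fun ⟨ζ, h, hη⟩ => (hη e hf hs).trans h⟩
      rw [hU]
      refine MeasurableSet.sUnion
        ((countable_range_cylinder (A n)).mono (Set.image_subset_range _ _)) ?_
      rintro _ ⟨ζ, -, rfl⟩
      exact MeasurableSpace.measurableSet_generateFrom ⟨n, ζ, rfl⟩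
    rw [show (Subtype.instMeasurableSpace : MeasurableSpace (GradConfig G)) =
      MeasurableSpace.comap Subtype.val MeasurableSpace.pi from rfl]
    refine Measurable.comap_le (@measurable_pi_lambda _ _ _ (_) _ _ he)
  · refine MeasurableSpace.generateFrom_le ?_
    rintro _ ⟨n, ζ, rfl⟩
    exact measurableSet_cylinder _ _
  -- Cylinders over nested sets are nested or disjoint, hence form a π-system.
  · have key : ∀ n m (ζ ζ' : GradConfig G), n ≤ m →
        (cylinder (A n) ζ ∩ cylinder (A m) ζ').Nonempty →
        cylinder (A n) ζ ∩ cylinder (A m) ζ' = cylinder (A m) ζ' := by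
      rintro n m ζ ζ' hnm ⟨η, h1, h2⟩
      refine Set.inter_eq_right.2 ?_
      rw [← cylinder_eq_of_mem h1, ← cylinder_eq_of_mem h2]
      exact cylinder_anti (hmono hnm) η
    rintro _ ⟨n, ζ, rfl⟩ _ ⟨m, ζ', rfl⟩ hne
    rcases le_total n m with hnm | hnm
    · exact ⟨m, ζ', key n m ζ ζ' hnm hne⟩
    · rw [Set.inter_comm] at hne ⊢
      exact ⟨n, ζ, key m n ζ' ζ hnm hne⟩
  · rintro _ ⟨n, ζ, rfl⟩
    exact h n ζ

lemma mem_awayDarts {w : V} {A : Finset V} {e : G.Dart} : e ∈ awayDarts G w A ↔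
    e.fst ∈ A ∧ e.snd ∈ A ∧ G.dist w e.snd = G.dist w e.fst + 1 := by
  simp [awayDarts, awayDartSet]

/-- Every vertex except the root is the head of exactly one outward edge, the one from its parent.
-/
lemma prod_awayDarts_snd [DecidableEq V] {M : Type*} [CommMonoid M] (hG : G.IsTree) {w : V}
    {A : Finset V} (hA : AncestorClosed G w A) (f : V → M) :
    ∏ e ∈ awayDarts G w A, f e.snd = ∏ y ∈ A.erase w, f y := by
  refine Finset.prod_bij (fun e _ => e.snd) ?_ ?_ ?_ (fun _ _ => rfl)
  · intro e he
    rw [mem_awayDarts] at he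
    refine Finset.mem_erase.2 ⟨fun h => ?_, he.2.1⟩
    rw [h] at he
    simp at he
  · intro e he e' he' h
    rw [mem_awayDarts] at he he'
    ext1
    exact Prod.ext (parent_unique hG e.adj (h ▸ e'.adj) he.2.2 (h ▸ he'.2.2)) h
  · intro y hy
    obtain ⟨hne, hyA⟩ := Finset.mem_erase.1 hy
    obtain ⟨x, hx, hd⟩ := exists_parent hG hne
    exact ⟨⟨(x, y), hx⟩, mem_awayDarts.2 ⟨hA.fst_mem hx hd hyA, hyA, hd⟩, rfl⟩

/-- A finite nontrivial tree has a leaf, whereas all degrees here are at least two. -/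
lemma exists_notMem_finset [G.LocallyFinite] (hG : G.IsTree) {d : ℕ} (hd : 1 ≤ d)
    (hreg : G.IsRegularOfDegree (d + 1)) (A : Finset V) : ∃ x, x ∉ A := by
  by_contra! h
  have : Fintype V := ⟨A, h⟩
  obtain ⟨w⟩ := hG.connected.nonempty
  have hpos : 0 < (G.neighborFinset w).card := by
    rw [SimpleGraph.card_neighborFinset_eq_degree, hreg w]
    omega
  obtain ⟨y, hy⟩ := Finset.card_pos.1 hpos
  have : Nontrivial V := ⟨w, y, ((G.mem_neighborFinset w y).1 hy).ne⟩
  classical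
  obtain ⟨v, hv⟩ := hG.exists_vert_degree_one_of_nontrivial
  have h1 := hreg v
  have h2 : G.degree v = 1 := by convert hv
  omega

end Tree

/-! ### Balls, outer boundaries and products over outward edges -/

section LocallyFinite

variable {V : Type*} [DecidableEq V] {G : SimpleGraph V} [G.LocallyFinite]

lemma mem_outerBoundary {Λ : Finset V} {y : V} :
    y ∈ outerBoundary G Λ ↔ (∃ x ∈ Λ, G.Adj x y) ∧ y ∉ Λ := by
  simp [outerBoundary]

lemma AncestorClosed.union_outerBoundary (hG : G.IsTree) {w : V} {Λ : Finset V}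
    (h : AncestorClosed G w Λ) : AncestorClosed G w (Λ ∪ outerBoundary G Λ) := by
  refine ⟨Finset.mem_union_left _ h.root_mem, fun x y hxy hd hy => Finset.mem_union_left _ ?_⟩
  rcases Finset.mem_union.1 hy with hy | hy
  · exact h.fst_mem hxy hd hy
  · obtain ⟨⟨z, hz, hzy⟩, hyn⟩ := mem_outerBoundary.1 hy
    rcases hG.dist_eq_dist_add_one_of_adj w hzy with hd' | hd'
    · exact absurd (h.fst_mem hzy.symm hd' hz) hyn
    · rwa [parent_unique hG hxy hzy hd hd']

/-- The ball of radius `n` around `w`. -/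
def finBall (G : SimpleGraph V) [G.LocallyFinite] (w : V) : ℕ → Finset V
  | 0 => {w}
  | n + 1 => finBall G w n ∪ outerBoundary G (finBall G w n)

lemma ancestorClosed_finBall (hG : G.IsTree) (w : V) (n : ℕ) :
    AncestorClosed G w (finBall G w n) := by
  induction n with
  | zero =>
    refine ⟨by simp [finBall], fun x y _ hd hy => ?_⟩
    rw [finBall, Finset.mem_singleton] at hy
    subst hy
    simp at hd
  | succ n ih => exact ih.union_outerBoundary hG

lemma monotone_finBall (w : V) : Monotone (finBall G w) :=
  monotone_nat_of_le_succ fun _ => Finset.subset_union_left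

lemma exists_mem_finBall (hG : G.IsTree) (w x : V) : ∃ n, x ∈ finBall G w n := by
  obtain ⟨p⟩ := hG.connected.preconnected x w
  induction p with
  | nil => exact ⟨0, by simp [finBall]⟩
  | @cons x y w h p ih =>
    obtain ⟨n, hn⟩ := ih
    by_cases hx : x ∈ finBall G w n
    · exact ⟨n, hx⟩
    · exact ⟨n + 1, Finset.mem_union_right _ (mem_outerBoundary_of_adj hn h.symm hx)⟩

lemma exists_subset_finBall (hG : G.IsTree) (w : V) (A : Finset V) :
    ∃ n, ∀ m, n ≤ m → A ⊆ finBall G w m := by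
  choose f hf using exists_mem_finBall hG w
  exact ⟨A.sup f, fun m hm x hx => monotone_finBall w ((Finset.le_sup hx).trans hm) (hf x)⟩

/-- A neighbour in `Λ` of a boundary vertex must be its parent: otherwise ancestor closure would put
the boundary vertex itself in `Λ`. So outward edges of the enlarged volume always start in `Λ`. -/
lemma mem_awayDarts_union_outerBoundary (hG : G.IsTree) {w : V} {Λ : Finset V}
    (h : AncestorClosed G w Λ) {e : G.Dart} :
    e ∈ awayDarts G w (Λ ∪ outerBoundary G Λ) ↔
      e.fst ∈ Λ ∧ G.dist w e.snd = G.dist w e.fst + 1 := by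
  rw [mem_awayDarts]
  constructor
  · rintro ⟨-, h2, h3⟩
    refine ⟨?_, h3⟩
    rcases Finset.mem_union.1 h2 with hy | hy
    · exact h.fst_mem e.adj h3 hy
    · obtain ⟨⟨z, hz, hzy⟩, hyn⟩ := mem_outerBoundary.1 hy
      rcases hG.dist_eq_dist_add_one_of_adj w hzy with hd' | hd'
      · exact absurd (h.fst_mem hzy.symm hd' hz) hyn
      · rwa [parent_unique hG e.adj hzy h3 hd']
  · rintro ⟨h1, h2⟩
    refine ⟨Finset.mem_union_left _ h1, ?_, h2⟩
    by_cases hs : e.snd ∈ Λ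
    · exact Finset.mem_union_left _ hs
    · exact Finset.mem_union_right _ (mem_outerBoundary_of_adj h1 e.adj hs)

/-- Each edge meeting `Λ` has exactly one outward orientation, so a product along the chain becomes
the unoriented product of the Gibbs weight. -/
lemma prod_awayDarts_edge {M : Type*} [CommMonoid M] (hG : G.IsTree) {w : V} {Λ : Finset V}
    (h : AncestorClosed G w Λ) (f : Sym2 V → M) :
    ∏ e ∈ awayDarts G w (Λ ∪ outerBoundary G Λ), f e.edge = ∏ b ∈ touchingEdges G Λ, f b := by
  refine Finset.prod_bij (fun e _ => e.edge) ?_ ?_ ?_ (fun _ _ => rfl)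
  · intro e he
    rw [mem_awayDarts_union_outerBoundary hG h] at he
    simp only [touchingEdges, Finset.mem_biUnion, SimpleGraph.mem_incidenceFinset]
    exact ⟨e.fst, he.1, e.edge_mem, Sym2.mem_mk_left _ _⟩
  · intro e he e' he' hee
    rw [mem_awayDarts_union_outerBoundary hG h] at he he'
    rcases (SimpleGraph.dart_edge_eq_iff e e').1 hee with rfl | rfl
    · rfl
    · have h1 := he.2
      have h2 := he'.2
      simp only [SimpleGraph.Dart.symm, Prod.fst_swap, Prod.snd_swap] at h1 h2
      omega
  · intro b hb
    simp only [touchingEdges, Finset.mem_biUnion, SimpleGraph.mem_incidenceFinset] at hb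
    obtain ⟨x, hx, hbx⟩ := hb
    obtain ⟨y, rfl⟩ := Sym2.mem_iff_exists.1 hbx.2
    have hadj : G.Adj x y := hbx.1
    rcases hG.dist_eq_dist_add_one_of_adj w hadj with hd | hd
    · exact ⟨⟨(y, x), hadj.symm⟩, (mem_awayDarts_union_outerBoundary hG h).2
        ⟨h.fst_mem hadj.symm hd hx, hd⟩, Sym2.eq_swap⟩
    · exact ⟨⟨(x, y), hadj⟩, (mem_awayDarts_union_outerBoundary hG h).2 ⟨hx, hd⟩, rfl⟩

lemma card_children (hG : G.IsTree) {d : ℕ} (hreg : G.IsRegularOfDegree (d + 1)) (w x : V) :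
    ((G.neighborFinset x).filter fun y => G.dist w y = G.dist w x + 1).card =
      if x = w then d + 1 else d := by
  split_ifs with hx
  · subst hx
    rw [Finset.filter_true_of_mem, SimpleGraph.card_neighborFinset_eq_degree, hreg x]
    intro y hy
    rw [SimpleGraph.mem_neighborFinset] at hy
    rcases hG.dist_eq_dist_add_one_of_adj x hy with hd | hd
    · simp at hd
    · exact hd
  · obtain ⟨z, hz, hd⟩ := exists_parent hG hx
    have : (G.neighborFinset x).filter (fun y => G.dist w y = G.dist w x + 1) =
        (G.neighborFinset x).erase z := by
      ext y
      simp only [Finset.mem_filter, Finset.mem_erase, SimpleGraph.mem_neighborFinset]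
      constructor
      · rintro ⟨hy, hyd⟩
        refine ⟨?_, hy⟩
        rintro rfl
        omega
      · rintro ⟨hne, hy⟩
        refine ⟨hy, ?_⟩
        rcases hG.dist_eq_dist_add_one_of_adj w hy with hd' | hd'
        · exact absurd (parent_unique hG hy.symm hz hd' hd) hne
        · exact hd'
    rw [this, Finset.card_erase_of_mem (by simpa using hz.symm),
      SimpleGraph.card_neighborFinset_eq_degree, hreg x]
    omega

/-- Grouping by tails gives one factor per child. The separate `f w` is the extra child of the root,
which has no parent. -/
lemma prod_awayDarts_fst {M : Type*} [CommMonoid M] (hG : G.IsTree) {d : ℕ}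
    (hreg : G.IsRegularOfDegree (d + 1)) {w : V} {Λ : Finset V}
    (h : AncestorClosed G w Λ) (f : V → M) :
    ∏ e ∈ awayDarts G w (Λ ∪ outerBoundary G Λ), f e.fst = f w * ∏ x ∈ Λ, f x ^ d := by
  classical
  rw [← Finset.prod_fiberwise_of_maps_to (t := Λ) (g := fun e : G.Dart => e.fst)
    (fun e he => ((mem_awayDarts_union_outerBoundary hG h).1 he).1)]
  have : ∀ x ∈ Λ, ∏ e ∈ (awayDarts G w (Λ ∪ outerBoundary G Λ)).filter (fun e => e.fst = x),
      f e.fst = f x ^ (if x = w then d + 1 else d) := by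
    intro x hx
    rw [Finset.prod_congr rfl (g := fun _ => f x) (fun e he => by rw [(Finset.mem_filter.1 he).2]),
      Finset.prod_const]
    congr 1
    rw [← card_children hG hreg w x]
    refine Finset.card_bij (fun e _ => e.snd) ?_ ?_ ?_
    · intro e he
      obtain ⟨h1, rfl⟩ := Finset.mem_filter.1 he
      exact Finset.mem_filter.2 ⟨by simp, ((mem_awayDarts_union_outerBoundary hG h).1 h1).2⟩
    · intro e he e' he' hee
      ext1
      exact Prod.ext ((Finset.mem_filter.1 he).2.trans (Finset.mem_filter.1 he').2.symm) hee
    · intro y hy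
      obtain ⟨h1, h2⟩ := Finset.mem_filter.1 hy
      exact ⟨⟨(x, y), by simpa using h1⟩, Finset.mem_filter.2
        ⟨(mem_awayDarts_union_outerBoundary hG h).2 ⟨hx, h2⟩, rfl⟩, rfl⟩
  rw [Finset.prod_congr rfl this, ← Finset.mul_prod_erase _ _ h.root_mem,
    ← Finset.mul_prod_erase Λ (fun x => f x ^ d) h.root_mem, if_pos rfl, pow_succ', mul_assoc]
  congr 2
  exact Finset.prod_congr rfl fun x hx => by rw [if_neg (Finset.ne_of_mem_erase hx)]

end LocallyFinite

/-! ### The fuzzy chain on layers and its reversible distribution -/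

section Fuzzy

/-- The normalization `∑_k Q(i-k) l(k)` of the transition matrix. -/
noncomputable def rowSum (Q : TransferOperator) (l : ℤ → ℝ) (i : ℤ) : ℝ :=
  ∑' k : ℤ, Q.val (i - k) * l k

variable {Q : TransferOperator} {l : ℤ → ℝ} {q : ℕ} [NeZero q]

lemma periodic_val_eq (hper : ∀ i : ℤ, l (i + q) = l i) (i : ℤ) :
    l (((i : ZMod q).val : ℤ)) = l i := by
  rw [ZMod.val_intCast, Int.emod_def, mul_comm]
  exact Function.Periodic.sub_zsmul_eq (f := l) hper (i / q)

lemma periodic_congr (hper : ∀ i : ℤ, l (i + q) = l i) {i j : ℤ} (h : (i : ZMod q) = j) :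
    l i = l j := by
  rw [← periodic_val_eq hper i, h, periodic_val_eq hper]

lemma summable_rowSum (hpos : ∀ i, 0 < l i) (hper : ∀ i : ℤ, l (i + q) = l i) (i : ℤ) :
    Summable fun k : ℤ => Q.val (i - k) * l k := by
  -- A periodic `l` takes finitely many values, so it is bounded and summability is inherited from
  -- `Q`.
  have hM : ∀ k, l k ≤ ∑ s : ZMod q, l (s.val : ℤ) := fun k => by
    rw [← periodic_val_eq hper k]
    exact Finset.single_le_sum (f := fun s : ZMod q => l (s.val : ℤ)) (fun _ _ => (hpos _).le)
      (Finset.mem_univ _)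
  have hQ : Summable fun k : ℤ => Q.val (i - k) :=
    (Equiv.subLeft i).summable_iff.2 Q.summable
  refine Summable.of_nonneg_of_le (fun k => (mul_pos (Q.pos _) (hpos _)).le) (fun k => ?_)
    (hQ.mul_right (∑ s : ZMod q, l (s.val : ℤ)))
  exact mul_le_mul_of_nonneg_left (hM k) (Q.pos _).le

lemma rowSum_pos (hpos : ∀ i, 0 < l i) (hper : ∀ i : ℤ, l (i + q) = l i) (i : ℤ) :
    0 < rowSum Q l i :=
  (summable_rowSum hpos hper i).tsum_pos (fun _ => (mul_pos (Q.pos _) (hpos _)).le) 0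
    (mul_pos (Q.pos _) (hpos _))

lemma rowSum_periodic {q : ℕ} (hper : ∀ i : ℤ, l (i + q) = l i) (i : ℤ) :
    rowSum Q l (i + q) = rowSum Q l i := by
  unfold rowSum
  rw [← (Equiv.addRight (q : ℤ)).tsum_eq]
  refine tsum_congr fun k => ?_
  simp [hper]

lemma hasSum_transition (hpos : ∀ i, 0 < l i) (hper : ∀ i : ℤ, l (i + q) = l i) (i : ℤ) :
    HasSum (transition Q l i) 1 := by
  have := (summable_rowSum (Q := Q) hpos hper i).hasSum.div_const (rowSum Q l i)
  rwa [show ∑' k : ℤ, Q.val (i - k) * l k = rowSum Q l i from rfl,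
    div_self (rowSum_pos hpos hper i).ne'] at this

lemma transition_pos (hpos : ∀ i, 0 < l i) (hper : ∀ i : ℤ, l (i + q) = l i) (i j : ℤ) :
    0 < transition Q l i j :=
  div_pos (mul_pos (Q.pos _) (hpos _)) (rowSum_pos hpos hper i)

lemma hasSum_layerTransition (hpos : ∀ i, 0 < l i) (hper : ∀ i : ℤ, l (i + q) = l i)
    (s : ZMod q) : HasSum (layerTransition Q l s) 1 :=
  (Equiv.addLeft (s.val : ℤ)).hasSum_iff.2 (hasSum_transition hpos hper (s.val : ℤ))

lemma layerTransition_pos (hpos : ∀ i, 0 < l i) (hper : ∀ i : ℤ, l (i + q) = l i)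
    (s : ZMod q) (m : ℤ) : 0 < layerTransition Q l s m :=
  transition_pos hpos hper _ _

lemma layerTransition_intCast (hper : ∀ i : ℤ, l (i + q) = l i) (h m : ℤ) :
    layerTransition Q l (h : ZMod q) m = Q.val m * l (h + m) / rowSum Q l h := by
  rw [layerTransition, transition]
  change Q.val _ * _ / rowSum Q l _ = _
  rw [periodic_val_eq (rowSum_periodic hper) h,
    periodic_congr hper (i := ((h : ZMod q).val : ℤ) + m) (j := h + m) (by simp)]
  congr 2
  rw [← Q.even]
  congr 1
  ring

/-- The sum of the transfer operator over the differences between two layers. -/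
noncomputable def layerCoupling (Q : TransferOperator) {q : ℕ} (s t : ZMod q) : ℝ :=
  ∑' j : {j : ℤ // (j : ZMod q) = t}, Q.val ((s.val : ℤ) - j)

/-- The reflection `j ↦ s + t - j` exchanges the two residue classes and reverses the sign of the
difference, which the even `Q` ignores. -/
lemma layerCoupling_comm (s t : ZMod q) : layerCoupling Q s t = layerCoupling Q t s := by
  let e : {j : ℤ // (j : ZMod q) = s} ≃ {j : ℤ // (j : ZMod q) = t} :=
    { toFun := fun j => ⟨(s.val : ℤ) + t.val - j.1, by simp [j.2]⟩
      invFun := fun j => ⟨(s.val : ℤ) + t.val - j.1, by simp [j.2]⟩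
      left_inv := fun j => by simp
      right_inv := fun j => by simp }
  unfold layerCoupling
  rw [← e.tsum_eq]
  refine tsum_congr fun j => ?_
  rw [← Q.even]
  congr 1
  simp only [e, Equiv.coe_fn_mk]
  ring

lemma fuzzyTransition_eq (hper : ∀ i : ℤ, l (i + q) = l i) (s t : ZMod q) :
    fuzzyTransition Q l s t =
      layerCoupling Q s t * l (t.val : ℤ) / rowSum Q l (s.val : ℤ) := by
  rw [fuzzyTransition, layerCoupling, ← tsum_mul_right, ← tsum_div_const]
  refine tsum_congr fun j => ?_
  rw [transition, periodic_congr hper (i := j) (j := (t.val : ℤ)) (by simp [j.2])]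
  rfl

lemma sum_fuzzyTransition (hpos : ∀ i, 0 < l i) (hper : ∀ i : ℤ, l (i + q) = l i) (s : ZMod q) :
    ∑ t, fuzzyTransition Q l s t = 1 := by
  have h := hasSum_transition (Q := Q) hpos hper (s.val : ℤ)
  have h2 := (Equiv.sigmaFiberEquiv (fun j : ℤ => (j : ZMod q))).hasSum_iff.2 h
  have h3 := h2.summable.tsum_sigma
  rw [h2.tsum_eq, tsum_fintype] at h3
  exact h3.symm

lemma fuzzyTransition_pos (hpos : ∀ i, 0 < l i) (hper : ∀ i : ℤ, l (i + q) = l i)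
    (s t : ZMod q) : 0 < fuzzyTransition Q l s t :=
  ((hasSum_transition (Q := Q) hpos hper (s.val : ℤ)).summable.subtype _).tsum_pos
    (fun _ => (transition_pos hpos hper _ _).le) ⟨(t.val : ℤ), by simp⟩
    (transition_pos hpos hper _ _)

/-- A strictly positive matrix has at most one invariant probability vector, given a strictly
positive one. -/
lemma eq_of_invariant_of_pos {ι : Type*} [Fintype ι] [Nonempty ι] {P : ι → ι → ℝ}
    (hP : ∀ s t, 0 < P s t) {α β : ι → ℝ} (hα : ∀ s, 0 < α s) (hα1 : ∑ s, α s = 1)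
    (hαP : ∀ t, ∑ s, α s * P s t = α t) (hβ1 : ∑ s, β s = 1)
    (hβP : ∀ t, ∑ s, β s * P s t = β t) : β = α := by
  -- With `r` the least ratio, `β - r α` is nonnegative, invariant and zero at `t`. Invariance at
  -- `t` writes this zero as a sum of nonnegative terms with positive coefficients, so the vector
  -- vanishes everywhere.
  obtain ⟨t, ht⟩ := Finite.exists_min fun s => β s / α s
  set r := β t / α t with hr
  have hnn : ∀ s, 0 ≤ β s - r * α s := fun s => by
    have := (le_div_iff₀ (hα s)).1 (ht s)
    linarith
  have hz : ∑ s, (β s - r * α s) * P s t = 0 := by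
    simp only [sub_mul, Finset.sum_sub_distrib, mul_assoc, ← Finset.mul_sum, hαP, hβP]
    rw [hr, div_mul_cancel₀ _ (hα t).ne', sub_self]
  have h0 : ∀ s, β s = r * α s := fun s => by
    have := (Finset.sum_eq_zero_iff_of_nonneg
      (fun s _ => mul_nonneg (hnn s) (hP s t).le)).1 hz s (Finset.mem_univ s)
    rcases mul_eq_zero.1 this with h | h
    · linarith
    · exact absurd h (hP s t).ne'
  have hr1 : r = 1 := by
    simp only [h0, ← Finset.mul_sum, hα1, mul_one] at hβ1
    exact hβ1
  funext s
  rw [h0, hr1, one_mul]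

/-- The total mass of the reversible measure of the fuzzy chain. -/
noncomputable def layerMass (Q : TransferOperator) (l : ℤ → ℝ) (q : ℕ) [NeZero q] : ℝ :=
  ∑ s : ZMod q, l (s.val : ℤ) * rowSum Q l (s.val : ℤ)

/-- The reversible distribution of the fuzzy chain. -/
noncomputable def layerDistribution (Q : TransferOperator) (l : ℤ → ℝ) {q : ℕ} [NeZero q]
    (s : ZMod q) : ℝ :=
  l (s.val : ℤ) * rowSum Q l (s.val : ℤ) / layerMass Q l q

lemma layerMass_pos (hpos : ∀ i, 0 < l i) (hper : ∀ i : ℤ, l (i + q) = l i) :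
    0 < layerMass Q l q :=
  Finset.sum_pos (fun _ _ => mul_pos (hpos _) (rowSum_pos hpos hper _)) Finset.univ_nonempty

lemma layerDistribution_pos (hpos : ∀ i, 0 < l i) (hper : ∀ i : ℤ, l (i + q) = l i)
    (s : ZMod q) : 0 < layerDistribution Q l s :=
  div_pos (mul_pos (hpos _) (rowSum_pos hpos hper _)) (layerMass_pos hpos hper)

lemma sum_layerDistribution (hpos : ∀ i, 0 < l i) (hper : ∀ i : ℤ, l (i + q) = l i) :
    ∑ s : ZMod q, layerDistribution Q l s = 1 := by
  simp only [layerDistribution, ← Finset.sum_div]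
  exact div_self (layerMass_pos hpos hper).ne'

/-- The row sums cancel and both sides equal `l(s) K(s,t) l(t) / Z`, where `K` is the symmetric
`layerCoupling`. -/
lemma layerDistribution_reversible (hpos : ∀ i, 0 < l i) (hper : ∀ i : ℤ, l (i + q) = l i)
    (s t : ZMod q) : layerDistribution Q l s * fuzzyTransition Q l s t =
      layerDistribution Q l t * fuzzyTransition Q l t s := by
  rw [fuzzyTransition_eq hper, fuzzyTransition_eq hper, layerCoupling_comm, layerDistribution,
    layerDistribution]
  have h1 := (rowSum_pos (Q := Q) hpos hper (s.val : ℤ)).ne'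
  have h2 := (rowSum_pos (Q := Q) hpos hper (t.val : ℤ)).ne'
  have h3 := (layerMass_pos (Q := Q) hpos hper).ne'
  field_simp

lemma isInvariantDistribution_layerDistribution (hpos : ∀ i, 0 < l i)
    (hper : ∀ i : ℤ, l (i + q) = l i) :
    IsInvariantDistribution Q l (layerDistribution Q l (q := q)) := by
  refine ⟨fun s => (layerDistribution_pos hpos hper s).le, sum_layerDistribution hpos hper,
    fun t => ?_⟩
  simp only [fun s => layerDistribution_reversible (Q := Q) hpos hper s t, ← Finset.mul_sum,
    sum_fuzzyTransition hpos hper, mul_one]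

lemma IsInvariantDistribution.eq_layerDistribution (hpos : ∀ i, 0 < l i)
    (hper : ∀ i : ℤ, l (i + q) = l i) {α : ZMod q → ℝ} (h : IsInvariantDistribution Q l α) :
    α = layerDistribution Q l :=
  have h' := isInvariantDistribution_layerDistribution (Q := Q) hpos hper
  eq_of_invariant_of_pos (fuzzyTransition_pos hpos hper) (layerDistribution_pos hpos hper)
    h'.2.1 h'.2.2 h.2.1 h.2.2

end Fuzzy

/-! ### Construction of the chain from a table of independent increments -/

section Chain

lemma exists_product_measure {ι : Type*} (p : ι → ℤ → ℝ) (hp : ∀ i m, 0 ≤ p i m)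
    (hp1 : ∀ i, HasSum (p i) 1) :
    ∃ μ : Measure (ι → ℤ), IsProbabilityMeasure μ ∧ ∀ (S : Finset ι) (x : ι → ℤ),
      μ (Set.pi S fun i => {x i}) = ∏ i ∈ S, ENNReal.ofReal (p i (x i)) := by
  let P : ι → PMF ℤ := fun i => ⟨fun m => ENNReal.ofReal (p i m), by
    have := (ENNReal.summable (f := fun m => ENNReal.ofReal (p i m))).hasSum
    rwa [← ENNReal.ofReal_tsum_of_nonneg (hp i) (hp1 i).summable, (hp1 i).tsum_eq,
      ENNReal.ofReal_one] at this⟩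
  refine ⟨Measure.infinitePi fun i => (P i).toMeasure, inferInstance, fun S x => ?_⟩
  rw [Measure.infinitePi_pi _ fun i _ => measurableSet_singleton _]
  refine Finset.prod_congr rfl fun i _ => ?_
  rw [PMF.toMeasure_apply_singleton _ _ (measurableSet_singleton _)]
  rfl

variable {V : Type*} {G : SimpleGraph V}

open Classical in
/-- The neighbour of `y` in the direction of `w`, with junk value `w` at `y = w`. -/
noncomputable def parent (G : SimpleGraph V) (w y : V) : V :=
  if h : ∃ x, G.Adj x y ∧ G.dist w y = G.dist w x + 1 then h.choose else w

lemma parent_eq (hG : G.IsTree) {w x y : V} (h : G.Adj x y)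
    (hd : G.dist w y = G.dist w x + 1) : parent G w y = x := by
  have hex : ∃ x, G.Adj x y ∧ G.dist w y = G.dist w x + 1 := ⟨x, h, hd⟩
  rw [parent, dif_pos hex]
  exact parent_unique hG hex.choose_spec.1 h hex.choose_spec.2 hd

/-- The height at a vertex at distance `n` from `w` of the chain started at `w` with height `0` in
the layer `s`, when the increments are taken from the table `X`. -/
noncomputable def chainHeightAux (G : SimpleGraph V) {q : ℕ} (w : V) (s : ZMod q)
    (X : V × ZMod q → ℤ) : ℕ → V → ℤ
  | 0, _ => 0
  | n + 1, y => chainHeightAux G w s X n (parent G w y) +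
      X (y, s + (chainHeightAux G w s X n (parent G w y) : ℤ))

/-- The heights of the chain started at `w` with height `0` in the layer `s`, when the increments
are taken from the table `X`. -/
noncomputable def chainHeight (G : SimpleGraph V) {q : ℕ} (w : V) (s : ZMod q)
    (X : V × ZMod q → ℤ) (y : V) : ℤ :=
  chainHeightAux G w s X (G.dist w y) y

lemma chainHeight_root {q : ℕ} (w : V) (s : ZMod q) (X : V × ZMod q → ℤ) :
    chainHeight G w s X w = 0 := by
  rw [chainHeight, SimpleGraph.dist_self]
  rfl

lemma chainHeight_step (hG : G.IsTree) {q : ℕ} {w : V} (s : ZMod q) (X : V × ZMod q → ℤ)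
    {x y : V} (h : G.Adj x y) (hd : G.dist w y = G.dist w x + 1) :
    chainHeight G w s X y =
      chainHeight G w s X x + X (y, s + (chainHeight G w s X x : ℤ)) := by
  rw [chainHeight, hd, chainHeightAux, parent_eq hG h hd]
  rfl

lemma measurable_chainHeight {q : ℕ} (w : V) (s : ZMod q) (y : V) :
    Measurable fun X => chainHeight G w s X y := by
  have : ∀ n y, Measurable fun X => chainHeightAux G w s X n y := by
    intro n
    induction n with
    | zero => intro y; exact measurable_const
    | succ n ih =>
      intro y
      refine (ih _).add (measurable_to_countable' fun k => ?_)
      -- The table entry being read is itself random; splitting by the countably many values of the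
      -- parent's height fixes its index.
      have : (fun X => X (y, s + (chainHeightAux G w s X n (parent G w y) : ℤ))) ⁻¹' {k} =
          ⋃ m : ℤ, (fun X => chainHeightAux G w s X n (parent G w y)) ⁻¹' {m} ∩
            (fun X : V × ZMod q → ℤ => X (y, s + (m : ZMod q))) ⁻¹' {k} := by
        ext X
        simp
      rw [this]
      exact MeasurableSet.iUnion fun m => (ih _ (measurableSet_singleton m)).inter
        (measurable_pi_apply _ (measurableSet_singleton k))
  exact this _ y

lemma layer_grad (hG : G.IsTree) {q : ℕ} (w : V) (s : ZMod q) (φ : V → ℤ) (y : V) :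
    layer hG w s (grad G φ) y = s + ((φ y - φ w : ℤ) : ZMod q) := by
  rw [layer, pathSum_grad]

/-- As long as the chain follows `ζ`, the layers it visits are those of `ζ`, so the event only
prescribes table entries at deterministic indices and independence applies. -/
lemma grad_chainHeight_mem_cylinder (hG : G.IsTree) {q : ℕ} {w : V} (s : ZMod q) {A : Finset V}
    (hA : AncestorClosed G w A) (X : V × ZMod q → ℤ) (ζ : GradConfig G) :
    grad G (chainHeight G w s X) ∈ cylinder A ζ ↔
      ∀ e ∈ awayDarts G w A, X (e.snd, layer hG w s ζ e.fst) = ζ.1 e := by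
  obtain ⟨ψ, rfl⟩ := exists_grad_eq hG ζ
  simp only [layer_grad]
  rw [mem_cylinder_grad hG hA, chainHeight_root]
  simp only [sub_zero]
  constructor
  · intro h e he
    rw [mem_awayDarts] at he
    have h1 := chainHeight_step hG s X e.adj he.2.2
    rw [h _ he.1, h _ he.2.1] at h1
    simp only [grad]
    linarith
  · intro h
    refine hA.induction hG (by simp [chainHeight_root]) fun x y hxy hd hx hy ih => ?_
    have h1 := h ⟨(x, y), hxy⟩ (mem_awayDarts.2 ⟨hx, hy, hd⟩)
    simp only [grad] at h1
    rw [chainHeight_step hG s X hxy hd, ih, h1]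
    ring

lemma exists_chain_measure (hG : G.IsTree) {Q : TransferOperator} {l : ℤ → ℝ} {q : ℕ} [NeZero q]
    (hpos : ∀ i, 0 < l i) (hper : ∀ i : ℤ, l (i + q) = l i) (w : V) (s : ZMod q) :
    ∃ μ : Measure (GradConfig G), IsProbabilityMeasure μ ∧ ∀ A, AncestorClosed G w A →
      ∀ ζ, μ.real (cylinder A ζ) = chainWeight hG Q l w s A ζ := by
  obtain ⟨P, hP, hPS⟩ := exists_product_measure
    (fun i : V × ZMod q => layerTransition Q l i.2)
    (fun i m => (layerTransition_pos hpos hper i.2 m).le)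
    (fun i => hasSum_layerTransition hpos hper i.2)
  have hmeas : Measurable fun X => grad G (chainHeight G w s X) :=
    measurable_grad.comp (measurable_pi_lambda _ (measurable_chainHeight w s))
  refine ⟨P.map fun X => grad G (chainHeight G w s X),
    Measure.isProbabilityMeasure_map hmeas.aemeasurable, fun A hA ζ => ?_⟩
  classical
  let idx : G.Dart → V × ZMod q := fun e => (e.snd, layer hG w s ζ e.fst)
  -- Different edges read different entries, since the head determines the outward edge; hence a
  -- single table `x` can carry all the prescribed values.
  have hinj : Set.InjOn idx (awayDarts G w A : Set G.Dart) := by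
    intro e he e' he' h
    rw [Finset.mem_coe, mem_awayDarts] at he he'
    have hs : e.snd = e'.snd := congrArg Prod.fst h
    ext1
    exact Prod.ext (parent_unique hG e.adj (hs ▸ e'.adj) he.2.2 (hs ▸ he'.2.2)) hs
  obtain ⟨x, hx⟩ : ∃ x : V × ZMod q → ℤ, ∀ e ∈ awayDarts G w A, x (idx e) = ζ.1 e := by
    refine ⟨fun i => if h : ∃ e ∈ awayDarts G w A, idx e = i then ζ.1 h.choose else 0,
      fun e he => ?_⟩
    have hex : ∃ e' ∈ awayDarts G w A, idx e' = idx e := ⟨e, he, rfl⟩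
    simp only [dif_pos hex]
    rw [hinj hex.choose_spec.1 he hex.choose_spec.2]
  have hset : (fun X => grad G (chainHeight G w s X)) ⁻¹' cylinder A ζ =
      Set.pi ((awayDarts G w A).image idx) fun i => {x i} := by
    ext X
    rw [Set.mem_preimage, grad_chainHeight_mem_cylinder hG s hA]
    simp only [Finset.coe_image, Set.mem_pi, Set.forall_mem_image, Set.mem_singleton_iff,
      Finset.mem_coe]
    exact forall₂_congr fun e he => by rw [hx e he]
  rw [measureReal_def, Measure.map_apply hmeas (measurableSet_cylinder A ζ), hset, hPS,
    Finset.prod_image hinj, ENNReal.toReal_prod]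
  refine Finset.prod_congr rfl fun e he => ?_
  rw [hx e he, ENNReal.toReal_ofReal (layerTransition_pos hpos hper _ _).le]

end Chain

/-! ### Boltzmann form of the chain weights -/

section Boltzmann

variable {V : Type*} [DecidableEq V] {G : SimpleGraph V} [G.LocallyFinite]

/-- The weight of a height configuration in a volume with boundary law terms on its outer
boundary. -/
noncomputable def boltzmannWeight (G : SimpleGraph V) [G.LocallyFinite] (Q : TransferOperator)
    (l : ℤ → ℝ) (Δ : Finset V) (φ : V → ℤ) : ℝ :=
  (∏ y ∈ outerBoundary G Δ, l (φ y)) * gibbsWeight G Q Δ φ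

lemma edgeFactor_pos {V : Type*} (Q : TransferOperator) (φ : V → ℤ) (b : Sym2 V) :
    0 < edgeFactor Q φ b := by
  induction b with
  | _ x y => exact Q.pos _

lemma gibbsWeight_pos (Q : TransferOperator) (Λ : Finset V) (φ : V → ℤ) :
    0 < gibbsWeight G Q Λ φ :=
  Finset.prod_pos fun _ _ => edgeFactor_pos _ _ _

lemma boltzmannWeight_pos {Q : TransferOperator} {l : ℤ → ℝ} (hpos : ∀ i, 0 < l i)
    (Δ : Finset V) (φ : V → ℤ) : 0 < boltzmannWeight G Q l Δ φ :=
  mul_pos (Finset.prod_pos fun _ _ => hpos _) (gibbsWeight_pos _ _ _)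

/-- The chain weights in a volume and its boundary have the Boltzmann form. -/
lemma chainWeight_eq_boltzmannWeight (hG : G.IsTree) {d : ℕ} (hreg : G.IsRegularOfDegree (d + 1))
    {Q : TransferOperator} {l : ℤ → ℝ} {q : ℕ} [NeZero q] (hpos : ∀ i, 0 < l i)
    (hper : ∀ i : ℤ, l (i + q) = l i) {c : ℝ} (hc : ∀ i, l i = c * rowSum Q l i ^ d) {w : V}
    {Δ : Finset V} (hΔ : AncestorClosed G w Δ) (φ : V → ℤ) :
    chainWeight hG Q l w (φ w : ZMod q) (Δ ∪ outerBoundary G Δ) (grad G φ) =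
      c ^ Δ.card / (l (φ w) * rowSum Q l (φ w)) * boltzmannWeight G Q l Δ φ := by
  have hD := hΔ.union_outerBoundary hG
  have h0 : ∀ e : G.Dart, layerTransition Q l (layer hG w (φ w : ZMod q) (grad G φ) e.fst)
      ((grad G φ).1 e) = edgeFactor Q φ e.edge * l (φ e.snd) / rowSum Q l (φ e.fst) := by
    intro e
    rw [layer_grad, ← Int.cast_add, add_sub_cancel, layerTransition_intCast hper]
    simp only [grad, add_sub_cancel]
    rfl
  rw [chainWeight, Finset.prod_congr rfl fun e _ => h0 e, Finset.prod_div_distrib,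
    Finset.prod_mul_distrib, prod_awayDarts_edge hG hΔ, prod_awayDarts_snd hG hD fun y => l (φ y),
    prod_awayDarts_fst hG hreg hΔ fun x => rowSum Q l (φ x)]
  -- The root is the head of no outward edge; supplying its factor `l (φ w)` completes the product
  -- over `Δ`, to which the boundary law equation then applies.
  have h1 : l (φ w) * ∏ y ∈ (Δ ∪ outerBoundary G Δ).erase w, l (φ y) =
      (∏ y ∈ Δ, l (φ y)) * ∏ y ∈ outerBoundary G Δ, l (φ y) := by
    rw [Finset.mul_prod_erase _ (fun y => l (φ y)) hD.root_mem, Finset.prod_union]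
    exact Finset.disjoint_sdiff
  have h2 : ∏ y ∈ Δ, l (φ y) = c ^ Δ.card * ∏ x ∈ Δ, rowSum Q l (φ x) ^ d := by
    rw [Finset.prod_congr rfl fun y _ => hc (φ y), Finset.prod_mul_distrib, Finset.prod_const]
  have h3 : 0 < ∏ x ∈ Δ, rowSum Q l (φ x) ^ d :=
    Finset.prod_pos fun x _ => pow_pos (rowSum_pos hpos hper _) _
  have h4 := rowSum_pos (Q := Q) hpos hper (φ w)
  have h5 := hpos (φ w)
  rw [h2] at h1
  rw [boltzmannWeight, gibbsWeight, div_mul_eq_mul_div, div_eq_div_iff (by positivity)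
    (by positivity)]
  linear_combination (∏ b ∈ touchingEdges G Δ, edgeFactor Q φ b) * rowSum Q l (φ w) * h1

end Boltzmann

section

variable {V : Type*} {G : SimpleGraph V}

lemma height_add (hG : G.IsTree) (ζ : GradConfig G) (w : V) (h : ℤ) :
    height hG ζ w h = fun x => height hG ζ w 0 x + h := by
  funext x
  simp only [height]
  ring

end

/-! ### Mixtures over the initial layer, and uniqueness of the measures -/

section Mixture

variable {V : Type*} [DecidableEq V] {G : SimpleGraph V} [G.LocallyFinite]
  {Q : TransferOperator} {l : ℤ → ℝ} {q : ℕ} [NeZero q]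

/-- The sum of the Boltzmann weights over one period of joint height shifts. -/
noncomputable def periodSum (G : SimpleGraph V) [G.LocallyFinite] (Q : TransferOperator)
    (l : ℤ → ℝ) (q : ℕ) [NeZero q] (Δ : Finset V) (φ : V → ℤ) : ℝ :=
  ∑ s : ZMod q, boltzmannWeight G Q l Δ fun x => φ x + (s.val : ℤ)

lemma boltzmannWeight_shift_period {q : ℕ} (hper : ∀ i : ℤ, l (i + q) = l i) (Δ : Finset V)
    (φ : V → ℤ) :
    boltzmannWeight G Q l Δ (fun x => φ x + (q : ℤ)) = boltzmannWeight G Q l Δ φ := by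
  rw [boltzmannWeight, boltzmannWeight, gibbsWeight_shift]
  simp only [hper]

/-- The weight depends on a joint shift only modulo `q`, and adding `k` permutes the residue
classes. -/
lemma periodSum_shift (hper : ∀ i : ℤ, l (i + q) = l i) (Δ : Finset V) (φ : V → ℤ) (k : ℤ) :
    periodSum G Q l q Δ (fun x => φ x + k) = periodSum G Q l q Δ φ := by
  let g : ℤ → ℝ := fun k => boltzmannWeight G Q l Δ fun x => φ x + k
  have hg : ∀ i : ℤ, g (i + q) = g i := fun i => by
    simp only [g, ← add_assoc]
    exact boltzmannWeight_shift_period hper Δ fun x => φ x + i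
  change ∑ s : ZMod q, boltzmannWeight G Q l Δ (fun x => φ x + k + (s.val : ℤ)) =
    ∑ s : ZMod q, g (s.val : ℤ)
  rw [← Equiv.sum_comp (Equiv.addLeft (k : ZMod q)) fun s : ZMod q => g (s.val : ℤ)]
  refine Finset.sum_congr rfl fun s _ => ?_
  simp only [add_assoc]
  exact periodic_congr hg (i := k + (s.val : ℤ)) (by simp)

lemma chainWeight_eq_boltzmannWeight_height (hG : G.IsTree) {d : ℕ}
    (hreg : G.IsRegularOfDegree (d + 1)) (hpos : ∀ i, 0 < l i)
    (hper : ∀ i : ℤ, l (i + q) = l i) {c : ℝ} (hc : ∀ i, l i = c * rowSum Q l i ^ d) {w : V}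
    {Δ : Finset V} (hΔ : AncestorClosed G w Δ) (s : ZMod q) (ζ : GradConfig G) :
    chainWeight hG Q l w s (Δ ∪ outerBoundary G Δ) ζ =
      c ^ Δ.card / (l (s.val : ℤ) * rowSum Q l (s.val : ℤ)) *
        boltzmannWeight G Q l Δ (height hG ζ w (s.val : ℤ)) := by
  have h := chainWeight_eq_boltzmannWeight hG hreg hpos hper hc hΔ (height hG ζ w (s.val : ℤ))
  have hw : height hG ζ w (s.val : ℤ) w = (s.val : ℤ) := by simp [height, pathSum_self]
  rw [hw, grad_height] at h
  simpa using h

lemma prod_layer_mul_gibbsWeight (hG : G.IsTree) (hper : ∀ i : ℤ, l (i + q) = l i) (w : V)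
    (s : ZMod q) (Δ : Finset V) (ζ : GradConfig G) :
    (∏ y ∈ outerBoundary G Δ, l ((layer hG w s ζ y).val : ℤ)) *
        gibbsWeight G Q Δ (height hG ζ w 0) =
      boltzmannWeight G Q l Δ (height hG ζ w (s.val : ℤ)) := by
  rw [boltzmannWeight, height_add hG ζ w (s.val : ℤ), gibbsWeight_shift]
  congr 1
  refine Finset.prod_congr rfl fun y _ => periodic_congr hper ?_
  simp [layer, height, add_comm]

/-- The mixture of the chain weights does not depend on the pinning vertex. -/
lemma sum_layerDistribution_mul_chainWeight (hG : G.IsTree) {d : ℕ}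
    (hreg : G.IsRegularOfDegree (d + 1)) (hpos : ∀ i, 0 < l i)
    (hper : ∀ i : ℤ, l (i + q) = l i) {c : ℝ} (hc : ∀ i, l i = c * rowSum Q l i ^ d) {w : V}
    {Δ : Finset V} (hΔ : AncestorClosed G w Δ) (φ : V → ℤ) :
    ∑ s : ZMod q, layerDistribution Q l s *
        chainWeight hG Q l w s (Δ ∪ outerBoundary G Δ) (grad G φ) =
      c ^ Δ.card / layerMass Q l q * periodSum G Q l q Δ φ := by
  -- The period sum ignores shifts, so `φ` may be replaced by the representative with height `0` at
  -- `w`; the two sums then match term by term.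
  obtain ⟨k, hk⟩ := exists_shift hG (grad_height hG (grad G φ) w 0)
  rw [show φ = fun x => height hG (grad G φ) w 0 x + k from funext hk, periodSum_shift hper,
    ← show φ = fun x => height hG (grad G φ) w 0 x + k from funext hk, periodSum, Finset.mul_sum]
  refine Finset.sum_congr rfl fun s _ => ?_
  rw [chainWeight_eq_boltzmannWeight_height hG hreg hpos hper hc hΔ, layerDistribution,
    ← height_add]
  have h1 := hpos (s.val : ℤ)
  have h2 := rowSum_pos (Q := Q) hpos hper (s.val : ℤ)
  have h3 := layerMass_pos (Q := Q) hpos hper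
  field_simp

/-- Two candidates could differ on a given volume only through the normalization constants, and
equal total mass forces these to agree. -/
lemma IsPinnedGradientMeasure.unique {q : ℕ} (hG : G.IsTree) {w : V} {s : ZMod q}
    {μ μ' : Measure (GradConfig G)} (h : IsPinnedGradientMeasure hG Q l w s μ)
    (h' : IsPinnedGradientMeasure hG Q l w s μ') : μ' = μ := by
  have := h.1
  have := h'.1
  refine measure_ext_of_cylinder (fun n => finBall G w (n + 1))
    (fun n m hnm => monotone_finBall w (by omega))
    (fun x => (exists_mem_finBall hG w x).imp fun n hn => monotone_finBall w (by omega) hn)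
    fun n ζ => ?_
  have hA := ancestorClosed_finBall hG w n
  obtain ⟨c, hc, hcμ⟩ := h.2 _ hA.root_mem (hA.connected hG)
  obtain ⟨c', hc', hcμ'⟩ := h'.2 _ hA.root_mem (hA.connected hG)
  have hk : ∀ ζ, μ'.real (cylinder (finBall G w n ∪ outerBoundary G (finBall G w n)) ζ) =
      c' / c * μ.real (cylinder (finBall G w n ∪ outerBoundary G (finBall G w n)) ζ) := by
    intro ζ
    rw [hcμ, hcμ']
    field_simp
  have h1 := eq_one_of_cylinder_proportional μ' μ _ (div_pos hc' hc) hk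
  have h2 := hk ζ
  rw [h1, one_mul] at h2
  exact (measureReal_eq_measureReal_iff).1 h2

lemma isPinnedGradientMeasure_of_chain (hG : G.IsTree) {d : ℕ}
    (hreg : G.IsRegularOfDegree (d + 1)) (hpos : ∀ i, 0 < l i)
    (hper : ∀ i : ℤ, l (i + q) = l i) {c : ℝ} (hc0 : 0 < c)
    (hc : ∀ i, l i = c * rowSum Q l i ^ d) {w : V} {s : ZMod q} {μ : Measure (GradConfig G)}
    [IsProbabilityMeasure μ]
    (h : ∀ A, AncestorClosed G w A → ∀ ζ, μ.real (cylinder A ζ) = chainWeight hG Q l w s A ζ) :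
    IsPinnedGradientMeasure hG Q l w s μ := by
  refine ⟨inferInstance, fun Λ hw hΛ => ?_⟩
  have hA := ancestorClosed_of_connected hG hw hΛ
  have h1 := hpos (s.val : ℤ)
  have h2 := rowSum_pos (Q := Q) hpos hper (s.val : ℤ)
  refine ⟨c ^ Λ.card / (l (s.val : ℤ) * rowSum Q l (s.val : ℤ)), by positivity, fun ζ => ?_⟩
  rw [h _ (hA.union_outerBoundary hG), mul_assoc, prod_layer_mul_gibbsWeight hG hper,
    chainWeight_eq_boltzmannWeight_height hG hreg hpos hper hc hA]

lemma isProbabilityMeasure_mixture {Ω ι : Type*} [MeasurableSpace Ω] [Fintype ι] {α : ι → ℝ}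
    (hα : ∀ s, 0 ≤ α s) (hα1 : ∑ s, α s = 1) (μ : ι → Measure Ω)
    [∀ s, IsProbabilityMeasure (μ s)] :
    IsProbabilityMeasure (∑ s, ENNReal.ofReal (α s) • μ s) := by
  refine ⟨?_⟩
  simp only [Measure.coe_finsetSum, Finset.sum_apply, Measure.smul_apply, measure_univ,
    smul_eq_mul, mul_one]
  rw [← ENNReal.ofReal_sum_of_nonneg fun s _ => hα s, hα1, ENNReal.ofReal_one]

lemma mixture_real_apply {Ω ι : Type*} [MeasurableSpace Ω] [Fintype ι] {α : ι → ℝ}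
    (hα : ∀ s, 0 ≤ α s) (μ : ι → Measure Ω) [∀ s, IsProbabilityMeasure (μ s)] (A : Set Ω) :
    (∑ s, ENNReal.ofReal (α s) • μ s).real A = ∑ s, α s * (μ s).real A := by
  simp only [measureReal_def, Measure.coe_finsetSum, Finset.sum_apply, Measure.smul_apply,
    smul_eq_mul]
  rw [ENNReal.toReal_sum fun s _ => ENNReal.mul_ne_top ENNReal.ofReal_ne_top (measure_ne_top _ _)]
  refine Finset.sum_congr rfl fun s _ => ?_
  rw [ENNReal.toReal_mul, ENNReal.toReal_ofReal (hα s)]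

lemma exists_mixture_measure (hG : G.IsTree) {d : ℕ} (hreg : G.IsRegularOfDegree (d + 1))
    (hpos : ∀ i, 0 < l i) (hper : ∀ i : ℤ, l (i + q) = l i) {c : ℝ} (hc0 : 0 < c)
    (hc : ∀ i, l i = c * rowSum Q l i ^ d) :
    ∃ ν : Measure (GradConfig G), IsProbabilityMeasure ν ∧
      (∀ w A, AncestorClosed G w A → ∀ ζ, ν.real (cylinder A ζ) =
        ∑ s : ZMod q, layerDistribution Q l s * chainWeight hG Q l w s A ζ) ∧
      ∀ w, ∃ μ : ZMod q → Measure (GradConfig G),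
        (∀ s, IsPinnedGradientMeasure hG Q l w s (μ s)) ∧
        ν = ∑ s : ZMod q, ENNReal.ofReal (layerDistribution Q l s) • μ s := by
  choose μ hμ hμw using fun (w : V) (s : ZMod q) =>
    exists_chain_measure hG (Q := Q) hpos hper w s
  have hα : ∀ s : ZMod q, 0 ≤ layerDistribution Q l s :=
    fun s => (layerDistribution_pos hpos hper s).le
  let ν : V → Measure (GradConfig G) :=
    fun w => ∑ s : ZMod q, ENNReal.ofReal (layerDistribution Q l s) • μ w s
  have hνprob : ∀ w, IsProbabilityMeasure (ν w) := fun w =>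
    isProbabilityMeasure_mixture hα (sum_layerDistribution hpos hper) (μ w)
  have hνcyl : ∀ w A, AncestorClosed G w A → ∀ ζ, (ν w).real (cylinder A ζ) =
      ∑ s : ZMod q, layerDistribution Q l s * chainWeight hG Q l w s A ζ := by
    intro w A hA ζ
    rw [mixture_real_apply hα]
    exact Finset.sum_congr rfl fun s _ => by rw [hμw w s A hA]
  have hνeq : ∀ w w', ν w = ν w' := by
    intro w w'
    -- Balls around `w` that contain `w'` are connected, hence ancestor closed for both roots. The
    -- radius `N + n + 1` is that of such a ball together with its outer boundary, where the common
    -- formula holds.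
    obtain ⟨N, hN⟩ := exists_mem_finBall hG w w'
    refine measure_ext_of_cylinder (fun n => finBall G w (N + n + 1))
      (fun n m hnm => monotone_finBall w (by omega))
      (fun x => (exists_mem_finBall hG w x).imp fun n hn => monotone_finBall w (by omega) hn)
      fun n ζ => (measureReal_eq_measureReal_iff).1 ?_
    have hA := ancestorClosed_finBall hG w (N + n)
    have hA' : AncestorClosed G w' (finBall G w (N + n)) :=
      ancestorClosed_of_connected hG (monotone_finBall w (by omega) hN) (hA.connected hG)
    obtain ⟨φ, rfl⟩ := exists_grad_eq hG ζ
    rw [finBall, hνcyl w _ (hA.union_outerBoundary hG), hνcyl w' _ (hA'.union_outerBoundary hG),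
      sum_layerDistribution_mul_chainWeight hG hreg hpos hper hc hA,
      sum_layerDistribution_mul_chainWeight hG hreg hpos hper hc hA']
  obtain ⟨r⟩ := hG.connected.nonempty
  refine ⟨ν r, hνprob r, fun w A hA ζ => by rw [hνeq r w, hνcyl w A hA], fun w =>
    ⟨μ w, fun s => isPinnedGradientMeasure_of_chain hG hreg hpos hper hc0 hc (hμw w s), hνeq r w⟩⟩

lemma HasMixtureMarginals.unique (hG : G.IsTree) {α : ZMod q → ℝ} {w : V}
    {ν ν' : Measure (GradConfig G)} [IsProbabilityMeasure ν] [IsProbabilityMeasure ν']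
    (h : HasMixtureMarginals hG Q l α w ν) (h' : HasMixtureMarginals hG Q l α w ν') : ν' = ν := by
  refine measure_ext_of_cylinder (finBall G w) (monotone_finBall w) (exists_mem_finBall hG w)
    fun n ζ => (measureReal_eq_measureReal_iff).1 ?_
  have hA := ancestorClosed_finBall hG w n
  rw [h _ hA.root_mem (hA.connected hG), h' _ hA.root_mem (hA.connected hG)]

end Mixture

/-! ### Equivariance under tree automorphisms -/

section Homogeneity

variable {V : Type*} {G : SimpleGraph V}

lemma measurable_automAct (τ : G ≃g G) : Measurable (automAct τ) :=
  Measurable.subtype_mk (measurable_pi_lambda _ fun _ => measurable_eval _)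

lemma automAct_grad (τ : G ≃g G) (φ : V → ℤ) : automAct τ (grad G φ) = grad G (φ ∘ τ) := rfl

lemma automAct_preimage_cylinder (τ : G ≃g G) (A : Finset V) (ζ : GradConfig G) :
    automAct τ ⁻¹' cylinder A (automAct τ ζ) = cylinder (A.map τ.toEquiv.toEmbedding) ζ := by
  ext η
  constructor
  · intro h e h1 h2
    obtain ⟨x, hx, hxe⟩ := Finset.mem_map.1 h1
    obtain ⟨y, hy, hye⟩ := Finset.mem_map.1 h2
    have hadj : G.Adj x y := τ.map_adj_iff.1 (by
      have := e.adj
      rwa [← hxe, ← hye] at this)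
    have h3 := h ⟨(x, y), hadj⟩ hx hy
    have h4 : τ.toHom.mapDart ⟨(x, y), hadj⟩ = e := by
      ext1
      exact Prod.ext hxe hye
    simpa only [automAct, h4] using h3
  · intro h e h1 h2
    exact h (τ.toHom.mapDart e) (Finset.mem_map_of_mem _ h1) (Finset.mem_map_of_mem _ h2)

lemma dist_automorphism (τ : G ≃g G) (hG : G.Connected) (x y : V) :
    G.dist (τ x) (τ y) = G.dist x y := by
  have key : ∀ (σ : G ≃g G) (x y : V), G.dist (σ x) (σ y) ≤ G.dist x y := by
    intro σ x y
    obtain ⟨p, hp⟩ := hG.exists_walk_length_eq_dist x y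
    rw [← hp, ← SimpleGraph.Walk.length_map σ.toHom p]
    exact SimpleGraph.dist_le _
  refine le_antisymm (key τ x y) ?_
  simpa using key τ.symm (τ x) (τ y)

lemma AncestorClosed.map (hG : G.IsTree) (τ : G ≃g G) {w : V} {A : Finset V}
    (h : AncestorClosed G w A) : AncestorClosed G (τ w) (A.map τ.toEquiv.toEmbedding) := by
  refine ⟨Finset.mem_map_of_mem _ h.root_mem, fun x y hxy hd hy => ?_⟩
  obtain ⟨y, hy', rfl⟩ := Finset.mem_map.1 hy
  obtain ⟨x, rfl⟩ := τ.surjective x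
  exact Finset.mem_map_of_mem _ (h.fst_mem (τ.map_adj_iff.1 hxy)
    (by rw [← dist_automorphism τ hG.connected, ← dist_automorphism τ hG.connected w x]; exact hd)
    hy')

lemma chainWeight_automAct (hG : G.IsTree) (Q : TransferOperator) (l : ℤ → ℝ) {q : ℕ}
    (τ : G ≃g G) (w : V) (s : ZMod q) (A : Finset V) (ζ : GradConfig G) :
    chainWeight hG Q l (τ w) s (A.map τ.toEquiv.toEmbedding) ζ =
      chainWeight hG Q l w s A (automAct τ ζ) := by
  obtain ⟨φ, rfl⟩ := exists_grad_eq hG ζ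
  symm
  rw [automAct_grad]
  refine Finset.prod_bij (fun e _ => τ.toHom.mapDart e) ?_ ?_ ?_ ?_
  · intro e he
    rw [mem_awayDarts] at he ⊢
    refine ⟨Finset.mem_map_of_mem _ he.1, Finset.mem_map_of_mem _ he.2.1, ?_⟩
    change G.dist (τ w) (τ e.snd) = G.dist (τ w) (τ e.fst) + 1
    rw [dist_automorphism τ hG.connected, dist_automorphism τ hG.connected, he.2.2]
  · intro e _ e' _ h
    ext1
    exact Prod.ext (τ.injective (congrArg (fun e : G.Dart => e.fst) h))
      (τ.injective (congrArg (fun e : G.Dart => e.snd) h))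
  · intro e he
    rw [mem_awayDarts] at he
    obtain ⟨h1, h2, h3⟩ := he
    obtain ⟨x, hx, hxe⟩ := Finset.mem_map.1 h1
    obtain ⟨y, hy, hye⟩ := Finset.mem_map.1 h2
    have hadj : G.Adj x y := τ.map_adj_iff.1 (by
      have := e.adj
      rwa [← hxe, ← hye] at this)
    refine ⟨⟨(x, y), hadj⟩, mem_awayDarts.2 ⟨hx, hy, ?_⟩, ?_⟩
    · rw [← hxe, ← hye] at h3
      rw [← dist_automorphism τ hG.connected, ← dist_automorphism τ hG.connected w x]
      exact h3
    · ext1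
      exact Prod.ext hxe hye
  · intro e _
    rw [layer_grad, layer_grad]
    rfl

end Homogeneity

/-! ### Factorization over a finite volume, the DLR equation and conditional probabilities -/

section Specification

variable {V : Type*} [DecidableEq V] {G : SimpleGraph V} [G.LocallyFinite]

lemma glue_apply_of_mem {V : Type*} [DecidableEq V] {Λ : Finset V} (σ : Λ → ℤ) (ω : V → ℤ) {x : V}
    (hx : x ∈ Λ) : glue Λ σ ω x = σ ⟨x, hx⟩ := dif_pos hx

lemma glue_apply_of_notMem {V : Type*} [DecidableEq V] {Λ : Finset V} (σ : Λ → ℤ) (ω : V → ℤ)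
    {x : V} (hx : x ∉ Λ) : glue Λ σ ω x = ω x := dif_neg hx

lemma mem_touchingEdges {Λ : Finset V} {x y : V} :
    s(x, y) ∈ touchingEdges G Λ ↔ G.Adj x y ∧ (x ∈ Λ ∨ y ∈ Λ) := by
  simp only [touchingEdges, Finset.mem_biUnion, SimpleGraph.mem_incidenceFinset,
    SimpleGraph.mk'_mem_incidenceSet_iff]
  constructor
  · rintro ⟨z, hz, hxy, rfl | rfl⟩
    exacts [⟨hxy, Or.inl hz⟩, ⟨hxy, Or.inr hz⟩]
  · rintro ⟨hxy, hx | hy⟩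
    exacts [⟨x, hx, hxy, Or.inl rfl⟩, ⟨y, hy, hxy, Or.inr rfl⟩]

lemma gibbsWeight_congr (Q : TransferOperator) {Λ Δ : Finset V} (hΛ : Λ ⊆ Δ) {φ ψ : V → ℤ}
    (h : ∀ y ∈ Δ ∪ outerBoundary G Δ, φ y = ψ y) : gibbsWeight G Q Λ φ = gibbsWeight G Q Λ ψ := by
  refine Finset.prod_congr rfl fun b hb => ?_
  induction b with
  | _ x y =>
    obtain ⟨hxy, hm⟩ := mem_touchingEdges.1 hb
    have key : ∀ u v, G.Adj u v → u ∈ Λ → φ u = ψ u ∧ φ v = ψ v := by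
      intro u v huv hu
      refine ⟨h _ (Finset.mem_union_left _ (hΛ hu)), h _ ?_⟩
      by_cases hv : v ∈ Δ
      · exact Finset.mem_union_left _ hv
      · exact Finset.mem_union_right _ (mem_outerBoundary_of_adj (hΛ hu) huv hv)
    have : φ x = ψ x ∧ φ y = ψ y := hm.elim (key x y hxy) fun hy => (key y x hxy.symm hy).symm
    simp [edgeFactor, this.1, this.2]

/-- The part of the Boltzmann weight in `Δ` that does not depend on the heights in `Λ ⊆ Δ`. -/
noncomputable def exteriorWeight (G : SimpleGraph V) [G.LocallyFinite] (Q : TransferOperator)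
    (l : ℤ → ℝ) (Λ Δ : Finset V) (φ : V → ℤ) : ℝ :=
  (∏ y ∈ outerBoundary G Δ, l (φ y)) *
    ∏ b ∈ touchingEdges G Δ \ touchingEdges G Λ, edgeFactor Q φ b

lemma exteriorWeight_pos {Q : TransferOperator} {l : ℤ → ℝ} (hpos : ∀ i, 0 < l i)
    (Λ Δ : Finset V) (φ : V → ℤ) : 0 < exteriorWeight G Q l Λ Δ φ :=
  mul_pos (Finset.prod_pos fun _ _ => hpos _) (Finset.prod_pos fun _ _ => edgeFactor_pos _ _ _)

lemma boltzmannWeight_glue (Q : TransferOperator) (l : ℤ → ℝ) {Λ Δ : Finset V} (hΛ : Λ ⊆ Δ)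
    (σ : Λ → ℤ) (ω : V → ℤ) : boltzmannWeight G Q l Δ (glue Λ σ ω) =
      gibbsWeight G Q Λ (glue Λ σ ω) * exteriorWeight G Q l Λ Δ ω := by
  have h1 : ∏ y ∈ outerBoundary G Δ, l (glue Λ σ ω y) = ∏ y ∈ outerBoundary G Δ, l (ω y) := by
    refine Finset.prod_congr rfl fun y hy => ?_
    rw [glue_apply_of_notMem _ _ fun hyΛ => (mem_outerBoundary.1 hy).2 (hΛ hyΛ)]
  have h2 : ∏ b ∈ touchingEdges G Δ \ touchingEdges G Λ, edgeFactor Q (glue Λ σ ω) b =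
      ∏ b ∈ touchingEdges G Δ \ touchingEdges G Λ, edgeFactor Q ω b := by
    refine Finset.prod_congr rfl fun b hb => ?_
    induction b with
    | _ x y =>
      obtain ⟨hb1, hb2⟩ := Finset.mem_sdiff.1 hb
      rw [mem_touchingEdges] at hb1 hb2
      have hx : x ∉ Λ := fun h => hb2 ⟨hb1.1, Or.inl h⟩
      have hy : y ∉ Λ := fun h => hb2 ⟨hb1.1, Or.inr h⟩
      simp [edgeFactor, glue_apply_of_notMem _ _ hx, glue_apply_of_notMem _ _ hy]
  have h3 : touchingEdges G Λ ⊆ touchingEdges G Δ :=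
    Finset.biUnion_subset_biUnion_of_subset_left _ hΛ
  rw [boltzmannWeight, exteriorWeight, h1, gibbsWeight, ← Finset.prod_sdiff h3, h2, gibbsWeight]
  ring

/-- Shifts affect only the exterior factor, so the Gibbs weight in `Λ` comes out of the sum over the
period. -/
lemma periodSum_glue (Q : TransferOperator) (l : ℤ → ℝ) (q : ℕ) [NeZero q] {Λ Δ : Finset V}
    (hΛ : Λ ⊆ Δ) (σ : Λ → ℤ) (ω : V → ℤ) : periodSum G Q l q Δ (glue Λ σ ω) =
      gibbsWeight G Q Λ (glue Λ σ ω) *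
        ∑ s : ZMod q, exteriorWeight G Q l Λ Δ fun x => ω x + (s.val : ℤ) := by
  rw [periodSum, Finset.mul_sum]
  refine Finset.sum_congr rfl fun s _ => ?_
  rw [← glue_shift, boltzmannWeight_glue Q l hΛ, glue_shift, gibbsWeight_shift]

/-- The vertex `r` outside `Λ` keeps its height and serves as a reference; without it, modifications
differing by a constant could have the same gradient on `A`. -/
lemma disjoint_cylinder_glue {V : Type*} [DecidableEq V] {G : SimpleGraph V}
    (hG : G.IsTree) {w r : V} {Λ A : Finset V} (hA : AncestorClosed G w A) (hΛ : Λ ⊆ A)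
    (hr : r ∈ A) (hrΛ : r ∉ Λ) (ω : V → ℤ) :
    Pairwise (Function.onFun Disjoint fun σ : Λ → ℤ => cylinder A (grad G (glue Λ σ ω))) := by
  intro σ σ' hne
  refine Set.disjoint_left.2 fun η h1 h2 => hne ?_
  have h : grad G (glue Λ σ ω) ∈ cylinder A (grad G (glue Λ σ' ω)) := by
    rw [← cylinder_eq_of_mem h2, cylinder_eq_of_mem h1]
    exact mem_cylinder_self _ _
  rw [mem_cylinder_grad_of_eq hG hA hr
    (by rw [glue_apply_of_notMem _ _ hrΛ, glue_apply_of_notMem _ _ hrΛ])] at h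
  funext x
  have := h x (hΛ x.2)
  rwa [glue_apply_of_mem _ _ x.2, glue_apply_of_mem _ _ x.2] at this

lemma partitionFunction_ne_zero (Q : TransferOperator) (Λ : Finset V) (ω : V → ℤ) :
    partitionFunction G Q Λ ω ≠ 0 := by
  intro h
  have := ENNReal.tsum_eq_zero.1 h fun _ => 0
  rw [ENNReal.ofReal_eq_zero] at this
  exact absurd (gibbsWeight_pos (G := G) Q Λ (glue Λ (fun _ => 0) ω)) (not_lt.2 this)

lemma partitionFunction_congr (Q : TransferOperator) {Λ Δ : Finset V} (hΛ : Λ ⊆ Δ)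
    {φ ψ : V → ℤ} (h : ∀ y ∈ Δ ∪ outerBoundary G Δ, y ∉ Λ → φ y = ψ y) :
    partitionFunction G Q Λ φ = partitionFunction G Q Λ ψ := by
  refine tsum_congr fun σ => ?_
  rw [gibbsWeight_congr Q hΛ fun y hy => ?_]
  by_cases hyΛ : y ∈ Λ
  · rw [glue_apply_of_mem _ _ hyΛ, glue_apply_of_mem _ _ hyΛ]
  · rw [glue_apply_of_notMem _ _ hyΛ, glue_apply_of_notMem _ _ hyΛ, h y hy hyΛ]

/-- The gradient kernel in `Λ`, evaluated at the event of agreeing with `∇ω` on a larger volume, is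
constant on each of the events of agreeing there with a modification of `ω` in `Λ`, and vanishes off
these events. -/
lemma gradSpec_cylinder (hG : G.IsTree) (Q : TransferOperator) {w r : V} {Λ Δ : Finset V}
    (hΛ : Λ ⊆ Δ) (hΔ : AncestorClosed G w (Δ ∪ outerBoundary G Δ))
    (hr : r ∈ Δ ∪ outerBoundary G Δ) (hrΛ : r ∉ Λ) (ω : V → ℤ) (ξ : GradConfig G) :
    gradSpec hG Q Λ ξ (cylinder (Δ ∪ outerBoundary G Δ) (grad G ω)) =
      ∑' τ : Λ → ℤ, (cylinder (Δ ∪ outerBoundary G Δ) (grad G (glue Λ τ ω))).indicator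
        (fun _ => (partitionFunction G Q Λ ω)⁻¹ * ENNReal.ofReal (gibbsWeight G Q Λ ω)) ξ := by
  set D := Δ ∪ outerBoundary G Δ with hD
  have hΛD : Λ ⊆ D := hΛ.trans Finset.subset_union_left
  -- The representative of `ξ` is chosen to agree with `ω` at `r`, a vertex the kernel never
  -- changes, so cylinder events become equalities of heights.
  obtain ⟨φ, rfl, hφr⟩ : ∃ φ, grad G φ = ξ ∧ φ r = ω r :=
    ⟨height hG ξ r (ω r), grad_height hG ξ r (ω r), by simp [height, pathSum_self]⟩
  rw [gradSpec_grad, map_gibbsSpec_apply Q Λ φ (measurableSet_cylinder _ _)]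
  have hL : ∀ σ : Λ → ℤ, grad G (glue Λ σ φ) ∈ cylinder D (grad G ω) ↔
      ∀ y ∈ D, glue Λ σ φ y = ω y := fun σ =>
    mem_cylinder_grad_of_eq hG hΔ hr (by rw [glue_apply_of_notMem _ _ hrΛ, hφr])
  have hR : ∀ τ : Λ → ℤ, grad G φ ∈ cylinder D (grad G (glue Λ τ ω)) ↔
      ∀ y ∈ D, φ y = glue Λ τ ω y := fun τ =>
    mem_cylinder_grad_of_eq hG hΔ hr (by rw [glue_apply_of_notMem _ _ hrΛ, hφr])
  by_cases hoff : ∀ y ∈ D, y ∉ Λ → φ y = ω y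
  -- On the left the kernel must resample `Λ` to `ω`; on the right the only modification of `ω`
  -- matching `ξ` is the one by `φ` on `Λ`.
  · rw [tsum_eq_single (fun x : Λ => ω x), tsum_eq_single (fun x : Λ => φ x)]
    · have h1 : ∀ y ∈ D, glue Λ (fun x : Λ => ω x) φ y = ω y := by
        intro y hy
        by_cases hyΛ : y ∈ Λ
        · rw [glue_apply_of_mem _ _ hyΛ]
        · rw [glue_apply_of_notMem _ _ hyΛ, hoff y hy hyΛ]
      have h2 : ∀ y ∈ D, φ y = glue Λ (fun x : Λ => φ x) ω y := by
        intro y hy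
        by_cases hyΛ : y ∈ Λ
        · rw [glue_apply_of_mem _ _ hyΛ]
        · rw [glue_apply_of_notMem _ _ hyΛ, hoff y hy hyΛ]
      rw [Set.indicator_of_mem ((hL _).2 h1), Set.indicator_of_mem ((hR _).2 h2),
        partitionFunction_congr Q hΛ hoff, gibbsWeight_congr Q hΛ h1, Pi.one_apply, mul_one]
    · intro τ hτ
      refine Set.indicator_of_notMem (fun h => hτ ?_) _
      funext x
      rw [(hR τ).1 h x (hΛD x.2), glue_apply_of_mem _ _ x.2]
    · intro σ hσ
      rw [Set.indicator_of_notMem, mul_zero]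
      refine fun h => hσ ?_
      funext x
      rw [← (hL σ).1 h x (hΛD x.2), glue_apply_of_mem _ _ x.2]
  · rw [ENNReal.tsum_eq_zero.2, ENNReal.tsum_eq_zero.2, mul_zero]
    · intro τ
      refine Set.indicator_of_notMem (fun h => hoff fun y hy hyΛ => ?_) _
      rw [(hR τ).1 h y hy, glue_apply_of_notMem _ _ hyΛ]
    · intro σ
      rw [Set.indicator_of_notMem, mul_zero]
      refine fun h => hoff fun y hy hyΛ => ?_
      rw [← (hL σ).1 h y hy, glue_apply_of_notMem _ _ hyΛ]

lemma measurable_gradSpec (hG : G.IsTree) (Q : TransferOperator) (Λ : Finset V) :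
    Measurable fun ζ => gradSpec hG Q Λ ζ :=
  (gradSpec hG Q Λ).measurable.mono (outerSigma_le hG Λ) le_rfl

section DLR

variable {ν : Measure (GradConfig G)} [IsProbabilityMeasure ν] {Q : TransferOperator}

/-- If the probabilities of agreeing with the modifications of `ω` in `Λ` are proportional to their
Gibbs weights, then the partition function is finite and the gradient kernel preserves the
probability of agreeing with `ω`. -/
lemma partitionFunction_ne_top_and_lintegral_gradSpec (hG : G.IsTree) {w r : V} {Λ Δ : Finset V}
    (hΛ : Λ ⊆ Δ) (hΔ : AncestorClosed G w (Δ ∪ outerBoundary G Δ))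
    (hr : r ∈ Δ ∪ outerBoundary G Δ) (hrΛ : r ∉ Λ) (ω : V → ℤ) {κ : ℝ} (hκ : 0 < κ)
    (hν : ∀ σ : Λ → ℤ, ν.real (cylinder (Δ ∪ outerBoundary G Δ) (grad G (glue Λ σ ω))) =
      κ * gibbsWeight G Q Λ (glue Λ σ ω)) :
    partitionFunction G Q Λ ω ≠ ⊤ ∧
      ∫⁻ ξ, gradSpec hG Q Λ ξ (cylinder (Δ ∪ outerBoundary G Δ) (grad G ω)) ∂ν =
        ν (cylinder (Δ ∪ outerBoundary G Δ) (grad G ω)) := by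
  have hν' : ∀ σ : Λ → ℤ, ν (cylinder (Δ ∪ outerBoundary G Δ) (grad G (glue Λ σ ω))) =
      ENNReal.ofReal κ * ENNReal.ofReal (gibbsWeight G Q Λ (glue Λ σ ω)) := fun σ => by
    rw [← ofReal_measureReal (μ := ν), hν, ENNReal.ofReal_mul hκ.le]
  have hsum : ∑' σ : Λ → ℤ, ν (cylinder (Δ ∪ outerBoundary G Δ) (grad G (glue Λ σ ω))) =
      ENNReal.ofReal κ * partitionFunction G Q Λ ω := by
    rw [tsum_congr hν', ENNReal.tsum_mul_left]
    rfl
  -- The cylinders are disjoint, so their probabilities, which are `κ` times the Gibbs weights, have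
  -- a finite sum.
  have htop : partitionFunction G Q Λ ω ≠ ⊤ := by
    intro h
    rw [h, ENNReal.mul_top (by simpa using hκ), ← measure_iUnion
      (disjoint_cylinder_glue hG hΔ (hΛ.trans Finset.subset_union_left) hr hrΛ ω)
      (fun _ => measurableSet_cylinder _ _)] at hsum
    exact measure_ne_top _ _ hsum
  refine ⟨htop, ?_⟩
  have hω : glue Λ (fun x : Λ => ω x) ω = ω := by
    funext x
    by_cases hx : x ∈ Λ
    · rw [glue_apply_of_mem _ _ hx]
    · rw [glue_apply_of_notMem _ _ hx]
  simp only [gradSpec_cylinder hG Q hΛ hΔ hr hrΛ ω]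
  rw [lintegral_tsum fun τ =>
    (measurable_const.indicator (measurableSet_cylinder _ _)).aemeasurable]
  simp only [lintegral_indicator_const (measurableSet_cylinder _ _)]
  have h1 := hν' fun x : Λ => ω x
  rw [hω] at h1
  rw [ENNReal.tsum_mul_left, hsum, h1]
  have h2 := ENNReal.inv_mul_cancel (partitionFunction_ne_zero (G := G) Q Λ ω) htop
  calc _ = ((partitionFunction G Q Λ ω)⁻¹ * partitionFunction G Q Λ ω) *
        (ENNReal.ofReal κ * ENNReal.ofReal (gibbsWeight G Q Λ ω)) := by ring
    _ = _ := by rw [h2, one_mul]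

lemma isProbabilityMeasure_gradSpec (hG : G.IsTree) {Λ : Finset V}
    (h : ∀ ω, partitionFunction G Q Λ ω ≠ ⊤) (ζ : GradConfig G) :
    IsProbabilityMeasure (gradSpec hG Q Λ ζ) := by
  obtain ⟨ω, rfl⟩ := exists_grad_eq hG ζ
  refine ⟨?_⟩
  rw [gradSpec_grad, map_gibbsSpec_apply Q Λ ω MeasurableSet.univ]
  simp only [Set.indicator_univ, Pi.one_apply, mul_one]
  exact ENNReal.inv_mul_cancel (partitionFunction_ne_zero Q Λ ω) (h ω)

/-- Connectedness of `Λ` plays no role: the comparison takes place in balls containing `Λ` and a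
reference vertex outside `Λ`, and the cylinders over such balls determine the measure. -/
lemma bind_gradSpec_eq (hG : G.IsTree) {l : ℤ → ℝ} {q : ℕ} [NeZero q] (hpos : ∀ i, 0 < l i)
    (w : V) {K : ℕ → ℝ} (hK : ∀ n, 0 < K n)
    (hν : ∀ n φ, ν.real (cylinder (finBall G w (n + 1)) (grad G φ)) =
      K n * periodSum G Q l q (finBall G w n) φ)
    (hinf : ∀ A : Finset V, ∃ x, x ∉ A) (Λ : Finset V) :
    (∀ ω, partitionFunction G Q Λ ω ≠ ⊤) ∧ ν.bind (gradSpec hG Q Λ) = ν := by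
  obtain ⟨r, hr⟩ := hinf Λ
  obtain ⟨N, hN⟩ := exists_subset_finBall hG w (insert r Λ)
  have key : ∀ n, N ≤ n → ∀ ω, partitionFunction G Q Λ ω ≠ ⊤ ∧
      ∫⁻ ξ, gradSpec hG Q Λ ξ (cylinder (finBall G w (n + 1)) (grad G ω)) ∂ν =
        ν (cylinder (finBall G w (n + 1)) (grad G ω)) := by
    intro n hn ω
    have hsub := Finset.insert_subset_iff.1 (hN n hn)
    refine partitionFunction_ne_top_and_lintegral_gradSpec hG hsub.2
      (ancestorClosed_finBall hG w (n + 1)) (Finset.mem_union_left _ hsub.1) hr ω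
      -- This is everything in the marginal that does not depend on the heights in `Λ`.
      (κ := K n * ∑ s : ZMod q, exteriorWeight G Q l Λ (finBall G w n)
        fun x => ω x + (s.val : ℤ)) ?_ fun σ => ?_
    · exact mul_pos (hK n)
        (Finset.sum_pos (fun _ _ => exteriorWeight_pos hpos _ _ _) Finset.univ_nonempty)
    · have := hν n (glue Λ σ ω)
      rw [periodSum_glue Q l q hsub.2] at this
      rw [mul_assoc, mul_comm (∑ s : ZMod q, _)]
      exact this
  have hZ : ∀ ω, partitionFunction G Q Λ ω ≠ ⊤ := fun ω => (key N le_rfl ω).1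
  refine ⟨hZ, ?_⟩
  have hprob := isProbabilityMeasure_gradSpec (Q := Q) hG hZ
  have hmeas := measurable_gradSpec hG Q Λ
  have : IsProbabilityMeasure (ν.bind (gradSpec hG Q Λ)) := by
    refine ⟨?_⟩
    rw [Measure.bind_apply MeasurableSet.univ hmeas.aemeasurable]
    simp
  refine measure_ext_of_cylinder (fun n => finBall G w (N + n + 1))
    (fun n m hnm => monotone_finBall w (by omega))
    (fun x => (exists_mem_finBall hG w x).imp fun n hn => monotone_finBall w (by omega) hn)
    fun n ζ => ?_
  obtain ⟨ω, rfl⟩ := exists_grad_eq hG ζ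
  rw [Measure.bind_apply (measurableSet_cylinder _ _) hmeas.aemeasurable]
  exact (key (N + n) (by omega) ω).2

end DLR

lemma mem_iff_glue_mem_of_outerSigma (hG : G.IsTree) {Λ : Finset V} {B : Set (GradConfig G)}
    (hB : MeasurableSet[outerSigma hG Λ] B) (ω : V → ℤ) (σ : Λ → ℤ) :
    grad G (glue Λ σ ω) ∈ B ↔ grad G ω ∈ B := by
  -- The sets that do not distinguish `ω` from its modification in `Λ` form a σ-algebra, so only the
  -- generators need checking; those involve heights off `Λ` alone.
  let m : MeasurableSpace (GradConfig G) :=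
    { MeasurableSet' := fun B => grad G (glue Λ σ ω) ∈ B ↔ grad G ω ∈ B
      measurableSet_empty := Iff.rfl
      measurableSet_compl := fun B h => not_congr h
      measurableSet_iUnion := fun f h => by
        simp only [Set.mem_iUnion]
        exact exists_congr h }
  suffices H : outerSigma hG Λ ≤ m from H B hB
  refine sup_le (iSup_le ?_) (iSup_le ?_)
  · rintro ⟨e, h1, h2⟩ _ ⟨S, -, rfl⟩
    change (grad G (glue Λ σ ω)).1 e ∈ S ↔ (grad G ω).1 e ∈ S
    simp only [grad, glue_apply_of_notMem _ _ h1, glue_apply_of_notMem _ _ h2]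
  · rintro ⟨⟨x, hx⟩, ⟨y, hy⟩⟩ _ ⟨S, -, rfl⟩
    change pathSum hG (grad G (glue Λ σ ω)) x y ∈ S ↔ pathSum hG (grad G ω) x y ∈ S
    rw [pathSum_grad, pathSum_grad, glue_apply_of_notMem _ _ (mem_outerBoundary.1 hx).2,
      glue_apply_of_notMem _ _ (mem_outerBoundary.1 hy).2]

/-- Resampling in `Λ` cannot change whether an exterior event occurs, so its indicator factors out
of the kernel. -/
lemma isProper_gradSpec (hG : G.IsTree) (Q : TransferOperator) (Λ : Finset V) :
    (gradSpec hG Q Λ).IsProper := by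
  rw [Kernel.isProper_iff_inter_eq_indicator_mul (outerSigma_le hG Λ)]
  intro A hA B hB ζ
  obtain ⟨ω, rfl⟩ := exists_grad_eq hG ζ
  rw [gradSpec_grad, map_gibbsSpec_apply Q Λ ω (hA.inter (outerSigma_le hG Λ _ hB)),
    map_gibbsSpec_apply Q Λ ω hA]
  by_cases h : grad G ω ∈ B
  · rw [Set.indicator_of_mem h, Pi.one_apply, one_mul]
    congr 1
    refine tsum_congr fun σ => ?_
    congr 1
    have := (mem_iff_glue_mem_of_outerSigma hG hB ω σ).2 h
    by_cases hA' : grad G (glue Λ σ ω) ∈ A <;> simp [hA', this]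
  · rw [Set.indicator_of_notMem h, zero_mul, ENNReal.tsum_eq_zero.2, mul_zero]
    intro σ
    rw [Set.indicator_of_notMem, mul_zero]
    exact fun h' => h ((mem_iff_glue_mem_of_outerSigma hG hB ω σ).1 h'.2)

variable {ν : Measure (GradConfig G)} [IsProbabilityMeasure ν] {Q : TransferOperator}

lemma isGradientGibbs_of_bind_eq (hG : G.IsTree)
    (hZ : ∀ Λ ω, partitionFunction G Q Λ ω ≠ ⊤) (h : ∀ Λ, ν.bind (gradSpec hG Q Λ) = ν) :
    IsGradientGibbs hG Q ν := by
  refine ⟨inferInstance, fun Λ F hF ⟨C, hC⟩ => ?_⟩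
  let γ : Kernel (GradConfig G) (GradConfig G) := ⟨_, measurable_gradSpec hG Q Λ⟩
  have hγ : IsMarkovKernel γ := ⟨isProbabilityMeasure_gradSpec hG (hZ Λ)⟩
  -- Regarding `ν` as a constant kernel lets the identity for measures be integrated against `F` by
  -- the formula for composed kernels.
  have hcomp : (γ ∘ₖ Kernel.const Unit ν) () = ν := by
    rw [Kernel.comp_apply, Kernel.const_apply]
    exact h Λ
  have hint : Integrable F ((γ ∘ₖ Kernel.const Unit ν) ()) :=
    Integrable.of_bound hF.aestronglyMeasurable C
      (Filter.Eventually.of_forall fun ζ => by simpa using hC ζ)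
  have := Kernel.integral_comp hint
  rwa [hcomp, Kernel.const_apply] at this

lemma hasGradientConditionals_of_bind_eq (hG : G.IsTree)
    (hZ : ∀ Λ ω, partitionFunction G Q Λ ω ≠ ⊤) (h : ∀ Λ, ν.bind (gradSpec hG Q Λ) = ν) :
    HasGradientConditionals hG Q ν := by
  intro Λ A hA
  have hprob := isProbabilityMeasure_gradSpec (Q := Q) hG (hZ Λ)
  have hle := outerSigma_le hG Λ
  have hm : Measurable[outerSigma hG Λ] fun ζ => (gradSpec hG Q Λ ζ).real A :=
    ((gradSpec hG Q Λ).measurable_coe hA).ennreal_toReal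
  have hint : Integrable (fun ζ => (gradSpec hG Q Λ ζ).real A) ν :=
    Integrable.of_bound (hm.mono hle le_rfl).aestronglyMeasurable 1
      (Filter.Eventually.of_forall fun ζ => by
        rw [Real.norm_of_nonneg measureReal_nonneg]
        exact measureReal_le_one)
  refine (ae_eq_condExp_of_forall_setIntegral_eq hle
    ((integrable_const (1 : ℝ)).indicator hA) (fun _ _ _ => hint.integrableOn)
    (fun B hB _ => ?_) hm.stronglyMeasurable.aestronglyMeasurable).symm
  -- Properness turns the integral over an exterior event `B` into the mass of `A ∩ B` under `ν`
  -- composed with the kernel, and that composition is `ν`.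
  have h1 := (isProper_gradSpec hG Q Λ).setLIntegral_eq_comp hle (μ := ν) hA hB
  rw [h Λ] at h1
  have h2 : ∫ ζ in B, (gradSpec hG Q Λ ζ).real A ∂ν = ν.real (A ∩ B) := by
    rw [measureReal_def, ← h1]
    exact integral_toReal (((gradSpec hG Q Λ).measurable_coe hA).mono hle le_rfl).aemeasurable
      (Filter.Eventually.of_forall fun ζ => measure_lt_top _ _)
  rw [h2, integral_indicator hA, setIntegral_const, measureReal_restrict_apply hA]
  simp

end Specification

end TreeGradient

/-! ### Assembly of the theorem -/

open TreeGradient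
theorem theorem3 {V : Type*} [DecidableEq V] (G : SimpleGraph V) [G.LocallyFinite]
    (hG : G.IsTree) (d : ℕ) (hd : 1 ≤ d) (hreg : G.IsRegularOfDegree (d + 1))
    (Q : TransferOperator) (q : ℕ) [NeZero q] (l : ℤ → ℝ) (hl : IsBoundaryLaw Q d l)
    (hper : ∀ i : ℤ, l (i + q) = l i) :
    ∃ α : ZMod q → ℝ,
      (IsInvariantDistribution Q l α ∧ ∀ α', IsInvariantDistribution Q l α' → α' = α) ∧
      ∃ ν : Measure (GradConfig G), IsProbabilityMeasure ν ∧
        (∀ w : V, HasMixtureMarginals hG Q l α w ν) ∧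
        (∀ (w : V) (ν' : Measure (GradConfig G)), IsProbabilityMeasure ν' →
          HasMixtureMarginals hG Q l α w ν' → ν' = ν) ∧
        (∀ w : V, ∃ μ : ZMod q → Measure (GradConfig G),
          (∀ s, IsPinnedGradientMeasure hG Q l w s (μ s) ∧
            ∀ μ', IsPinnedGradientMeasure hG Q l w s μ' → μ' = μ s) ∧
          ν = ∑ s, ENNReal.ofReal (α s) • μ s) ∧
        IsHomogeneous ν ∧
        IsGradientGibbs hG Q ν ∧
        HasGradientConditionals hG Q ν := by
  obtain ⟨hpos, c, hc0, hc⟩ := hl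
  refine ⟨layerDistribution Q l, ⟨isInvariantDistribution_layerDistribution hpos hper,
    fun α' h => h.eq_layerDistribution hpos hper⟩, ?_⟩
  obtain ⟨ν, hν, hcyl, hpin⟩ := exists_mixture_measure hG hreg hpos hper hc0 hc
  have hmix : ∀ w, HasMixtureMarginals hG Q l (layerDistribution Q l (q := q)) w ν :=
    fun w A hw hA ζ => hcyl w A (ancestorClosed_of_connected hG hw hA) ζ
  obtain ⟨w₀⟩ := hG.connected.nonempty
  have hbind : ∀ Λ, (∀ ω, partitionFunction G Q Λ ω ≠ ⊤) ∧ ν.bind (gradSpec hG Q Λ) = ν := by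
    refine bind_gradSpec_eq (l := l) (q := q) hG hpos w₀
      (K := fun n => c ^ (finBall G w₀ n).card / layerMass Q l q)
      (fun n => div_pos (pow_pos hc0 _) (layerMass_pos hpos hper)) (fun n φ => ?_)
      (exists_notMem_finset hG hd hreg)
    have hA := ancestorClosed_finBall hG w₀ n
    rw [finBall, hcyl w₀ _ (hA.union_outerBoundary hG),
      sum_layerDistribution_mul_chainWeight hG hreg hpos hper hc hA]
  refine ⟨ν, hν, hmix, fun w ν' hν' h => (hmix w).unique hG h, fun w => ?_, fun τ => ?_,
    isGradientGibbs_of_bind_eq hG (fun Λ => (hbind Λ).1) fun Λ => (hbind Λ).2,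
    hasGradientConditionals_of_bind_eq hG (fun Λ => (hbind Λ).1) fun Λ => (hbind Λ).2⟩
  · obtain ⟨μ, hμ, hνμ⟩ := hpin w
    exact ⟨μ, fun s => ⟨hμ s, fun μ' h => (hμ s).unique hG h⟩, hνμ⟩
  · have hprob : IsProbabilityMeasure (ν.map (automAct τ)) :=
      Measure.isProbabilityMeasure_map (measurable_automAct τ).aemeasurable
    -- By uniqueness it suffices to compute marginals pinned at `w₀`. The image measure has the
    -- marginals of `ν` pinned at `τ w₀`, which equivariance of the chain weights carries back to
    -- `w₀`.
    refine (hmix w₀).unique hG fun A hw hA ζ => ?_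
    have hA' := ancestorClosed_of_connected hG hw hA
    obtain ⟨φ, rfl⟩ := exists_grad_eq hG ζ
    have hζ : grad G φ = automAct τ (grad G (φ ∘ τ.symm)) := by
      rw [automAct_grad]
      congr 1
      funext x
      simp
    rw [hζ, measureReal_def, Measure.map_apply (measurable_automAct τ)
      (measurableSet_cylinder _ _), automAct_preimage_cylinder, ← measureReal_def,
      hcyl (τ w₀) _ (hA'.map hG τ)]
    simp only [chainWeight_automAct]
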